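/- Let $\mathcal G=(V,E)$ be a finite simple graph (no loop-edges, no multiple edges), with conductances $C_{x,y}=C_{y,x}\ge 0$ that vanish unless $\{x,y\}\in E$, and a killing measure $\kappa_x\ge 0$ on $V$. Assume that the energy $$\mathcal E(f,f)=\tfrac12\sum_{x,y}C_{x,y}(f(x)-f(y))^2+\sum_x\kappa_x f(x)^2$$ is positive definite. Put $\lambda_x=\sum_yC_{x,y}+\kappa_x$ and $P_{x,y}=C_{x,y}/\lambda_x$. **Loops and the field $N^{(1)}$.** Let $(X_t)$ be the continuous-time Markov process with jump matrix $P$ (killed with probability $1-\sum_yP_{x,y}$ at a jump from $x$) and independent exponential holding times of mean $1$. The measure on based loops $$\sum_{x}\int_0^\infty \frac1t\,\mathbb P_x\big(X_t=x,\ (X_s)_{0\le s\le t}\in\cdot\,\big)\,dt$$ induces a measure $\mu$ on loops, i.e. on based loops up to time-shift. Let $\mathcal L_1$ be a Poisson process of loops with intensity $\mu$, and for $x\neq y$ let $N^{(1)}_{x,y}$ be the total number of jumps from $x$ to $y$ made by the loops of $\mathcal L_1$ (and $N^{(1)}_{x,x}=0$). **Eulerian networks.** An Eulerian network is a matrix $k=(k_{x,y})_{x,y\in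 V}$ of nonnegative integers with $k_{x,y}=0$ unless $\{x,y\}\in E$, and $\sum_yk_{x,y}=\sum_yk_{y,x}$ for all $x$. **Configurations.** A configuration $c\in\mathfrak C$ consists of integers $c_x\ge0$ $(x\in V)$, giving $c_x$ exiting and $c_x$ entering half-edges, each numbered from $1$ to $c_x$, at each vertex $x$, together with a bijection (coupling) from the set of all exiting half-edges to the set of all entering half-edges such that an exiting half-edge at $x$ can be coupled with an entering half-edge at $y$ only if $\{x,y\}\in E$. Let $c_{x,y}$ be the number of half-edges exiting from $x$ coupled with half-edges entering in $y$. Then $\sum_yc_{x,y}=\sum_yc_{y,x}=c_x$, so $\tilde c=(c_{x,y})$ is an Eulerian network. **Theorem.** The weights $$Q(c)=\det(I-P)\,\frac1{\prod_xc_x!}\,\prod_{x,y}P_{x,y}^{c_{x,y}},\qquad c\in\mathfrak C,$$ are nonnegative and define a probability measure $Q$ on $\mathfrak C$, and the image of $Q$ under the projection $c\mapsto\tilde c$ is the law of $N^{(1)}$. -/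

import Mathlib

open MeasureTheory ProbabilityTheory
open scoped ENNReal NNReal

noncomputable section

namespace LoopNetworks

/-! ### Conductances, energy, transition matrix -/

/-- Nonnegative symmetric conductances carried by the edges of the graph `G`, together with a
nonnegative killing measure on the vertices. -/
structure Conductances {V : Type*} (G : SimpleGraph V) where
  /-- the conductances -/
  C : V → V → ℝ
  /-- the killing measure -/
  κ : V → ℝ
  C_symm : ∀ x y, C x y = C y x
  C_nonneg : ∀ x y, 0 ≤ C x y
  C_eq_zero : ∀ x y, ¬ G.Adj x y → C x y = 0
  κ_nonneg : ∀ x, 0 ≤ κ x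

namespace Conductances

variable {V : Type*} [Fintype V] {G : SimpleGraph V} (D : Conductances G)

/-- The energy (Dirichlet form) of a function `f`. -/
def energy (f : V → ℝ) : ℝ :=
  (1 / 2) * ∑ x, ∑ y, D.C x y * (f x - f y) ^ 2 + ∑ x, D.κ x * f x ^ 2

/-- Positive definiteness of the energy (the transience assumption). -/
def IsTransient : Prop := ∀ f : V → ℝ, f ≠ 0 → 0 < D.energy f

/-- The duality measure `λ`. -/
def dualityMeasure (x : V) : ℝ := ∑ y, D.C x y + D.κ x

/-- The transition matrix `P` of the (killed) Markov chain. -/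
def transition : Matrix V V ℝ := Matrix.of fun x y => D.C x y / D.dualityMeasure x

end Conductances

/-! ### Continuous-time loops and the loop measure -/

/-- The sequence of successive positions `ξ 0, …, ξ n`, with `ξ n = ξ 0`, of a closed trajectory
with `n` jumps. -/
abbrev ClosedTrajectory (V : Type*) : Type _ :=
  Σ n : ℕ, {ξ : Fin (n + 1) → V // ξ (Fin.last n) = ξ 0}

/-- A based loop in continuous time: a closed trajectory `ξ 0, …, ξ n`, together with the successive
times `h 0, …, h n` spent at these positions (`h n` is the time spent at `ξ n` after the last jump).
The duration of the loop is `h 0 + ⋯ + h n`. The σ-algebra is the canonical one: discrete in the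
trajectory, Borel in the holding times. -/
abbrev BasedLoop (V : Type*) : Type _ :=
  Σ w : ClosedTrajectory V, (Fin (w.1 + 1) → ℝ)

/-- For the Markov process with exponential holding times of mean `1`, the joint density of "exactly
`n` jumps before time `t`, with given holding times `h 0, …, h n` of sum `t`" is `e ^ (-t)` (times
the jump probabilities). The loop measure integrates this against `dt / t`. -/
def holdingMeasure (n : ℕ) : Measure (Fin (n + 1) → ℝ) :=
  (volume.restrict {h | ∀ i, 0 < h i}).withDensity
    fun h => ENNReal.ofReal (Real.exp (-∑ i, h i) / ∑ i, h i)

/-- The measure `∑ x, ∫ (1 / t) ℙ_x (X_t = x, ·) dt` on based loops, for the continuous-time Markov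
process `X` with jump matrix `P` and exponential holding times of mean `1`. -/
def basedLoopMeasure {V : Type*} (P : Matrix V V ℝ) : Measure (BasedLoop V) :=
  Measure.sum fun w : ClosedTrajectory V =>
    ENNReal.ofReal (∏ i : Fin w.1, P (w.2.1 i.castSucc) (w.2.1 i.succ)) •
      (holdingMeasure w.1).map (Sigma.mk w)

/-- A loop is a based loop up to a shift of time, i.e. a cyclic sequence of (position, holding time)
pairs. -/
def Loop (V : Type*) : Type _ := Cycle (V × ℝ)

/-- Forget the base point of a based loop. As soon as there is a jump, the time spent at the base
point before the first jump and the time spent there after the last jump are parts of the same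
visit. -/
def BasedLoop.toLoop {V : Type*} : BasedLoop V → Loop V
  | ⟨⟨0, ξ⟩, h⟩ => (([(ξ.1 0, h 0)] : List (V × ℝ)) : Cycle (V × ℝ))
  | ⟨⟨n + 1, ξ⟩, h⟩ =>
    ((List.ofFn fun i : Fin (n + 1) =>
      (ξ.1 i.castSucc, if i = 0 then h 0 + h (Fin.last (n + 1)) else h i.castSucc) :
        List (V × ℝ)) : Cycle (V × ℝ))

/-- The quotient σ-algebra on the space of loops. -/
instance (V : Type*) : MeasurableSpace (Loop V) :=
  MeasurableSpace.map BasedLoop.toLoop inferInstance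

/-- The loop measure `μ` of the Markov process with jump matrix `P`. -/
def loopMeasure {V : Type*} (P : Matrix V V ℝ) : Measure (Loop V) :=
  (basedLoopMeasure P).map BasedLoop.toLoop

/-- The pairs of cyclically consecutive positions in a list of (position, holding time) pairs. -/
def steps {V : Type*} (l : List (V × ℝ)) : List (V × V) :=
  List.zipWith (fun a b => (a.1, b.1)) l (l.rotate 1)

lemma steps_perm {V : Type*} {l l' : List (V × ℝ)} (h : l.IsRotated l') :
    (steps l).Perm (steps l') := by
  obtain ⟨n, rfl⟩ := h
  have key : steps (l.rotate n) = (steps l).rotate n := by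
    unfold steps
    rw [List.zipWith_rotate_distrib _ _ _ _ (by simp), List.rotate_rotate, List.rotate_rotate,
      add_comm]
  rw [key]
  exact (List.rotate_perm _ _).symm

/-- The number of jumps from `x` to `y` made by a loop (a jump changes the position, so this is `0`
for `x = y`; in particular one-point loops make no jump). -/
def Loop.jumps {V : Type*} [DecidableEq V] (x y : V) (ℓ : Loop V) : ℕ :=
  if x = y then 0 else
    Quotient.liftOn (s := List.IsRotated.setoid (V × ℝ)) ℓ (fun l => (steps l).count (x, y))
      fun _ _ h => (steps_perm h).count_eq _

/-! ### Poisson ensembles and the jump field -/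

/-- The random measure `Λ` is a Poisson process of intensity `ν` (the random set of points is
identified with the sum of the Dirac masses at its points). -/
structure IsPoissonProcess {Ω E : Type*} [MeasurableSpace Ω] [MeasurableSpace E]
    (Λ : Ω → Measure E) (ν : Measure E) (μ : Measure Ω) : Prop where
  measurable : Measurable Λ
  hasLaw : ∀ A : Set E, MeasurableSet A → ν A ≠ ∞ →
    HasLaw (fun ω => Λ ω A)
      ((poissonMeasure (ν A).toNNReal).map fun n : ℕ => (n : ℝ≥0∞)) μ
  eq_top : ∀ A : Set E, MeasurableSet A → ν A = ∞ → ∀ᵐ ω ∂μ, Λ ω A = ∞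
  indep : ∀ (n : ℕ) (A : Fin n → Set E), (∀ i, MeasurableSet (A i)) →
    Pairwise (fun i j => Disjoint (A i) (A j)) → iIndepFun (fun i ω => Λ ω (A i)) μ

/-- The total number of jumps from `x` to `y` made by the loops of a (counting measure on a) set of
loops. -/
def jumpField {V : Type*} [DecidableEq V] (Λ : Measure (Loop V)) (x y : V) : ℝ≥0∞ :=
  ∫⁻ ℓ, (Loop.jumps x y ℓ : ℝ≥0∞) ∂Λ

/-! ### Eulerian networks and half-edge configurations -/

/-- An Eulerian network on `G`: an `ℕ`-valued matrix vanishing outside the oriented edges of `G`,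
with equal inflow and outflow at each vertex. -/
structure EulerianNetwork {V : Type*} [Fintype V] (G : SimpleGraph V) where
  /-- the matrix -/
  k : V → V → ℕ
  k_eq_zero : ∀ x y, ¬ G.Adj x y → k x y = 0
  eulerian : ∀ x, ∑ y, k x y = ∑ y, k y x

instance {V : Type*} [Fintype V] (G : SimpleGraph V) : MeasurableSpace (EulerianNetwork G) := ⊤

/-- An Eulerian network seen as a matrix with (finite) coefficients in `[0, ∞]`. -/
def EulerianNetwork.toENNReal {V : Type*} [Fintype V] {G : SimpleGraph V}
    (k : EulerianNetwork G) : V → V → ℝ≥0∞ :=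
  fun x y => (k.k x y : ℝ≥0∞)

/-- A configuration: `deg x` exiting and `deg x` entering numbered half-edges at each vertex `x`,
and a coupling sending each exiting half-edge to an entering one, in such a way that they form an
oriented edge of `G`. -/
structure Configuration {V : Type*} (G : SimpleGraph V) where
  /-- the number `c_x` of exiting (and of entering) half-edges at `x` -/
  deg : V → ℕ
  /-- the coupling, from exiting half-edges to entering half-edges -/
  coupling : (Σ x, Fin (deg x)) ≃ (Σ x, Fin (deg x))
  adj : ∀ e, G.Adj e.1 (coupling e).1

instance {V : Type*} (G : SimpleGraph V) : MeasurableSpace (Configuration G) := ⊤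

namespace Configuration

variable {V : Type*} [DecidableEq V] {G : SimpleGraph V}

/-- The number `c_{x,y}` of half-edges exiting from `x` coupled with half-edges entering in `y`. -/
def count (c : Configuration G) (x y : V) : ℕ :=
  Fintype.card {i : Fin (c.deg x) // (c.coupling ⟨x, i⟩).1 = y}

lemma count_eq_zero (c : Configuration G) (x y : V) (h : ¬ G.Adj x y) : c.count x y = 0 := by
  refine Fintype.card_eq_zero_iff.2 ⟨fun i => h ?_⟩
  have := c.adj ⟨x, i.1⟩
  rwa [i.2] at this

variable [Fintype V]

lemma sum_count (c : Configuration G) (x : V) : ∑ y, c.count x y = c.deg x := by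
  have h := Fintype.card_congr (Equiv.sigmaFiberEquiv fun i : Fin (c.deg x) => (c.coupling ⟨x, i⟩).1)
  rw [Fintype.card_sigma, Fintype.card_fin] at h
  exact h

lemma sum_count' (c : Configuration G) (x : V) : ∑ y, c.count y x = c.deg x := by
  have h : ∀ y, c.count y x = ∑ i : Fin (c.deg y), if (c.coupling ⟨y, i⟩).1 = x then 1 else 0 := by
    intro y
    rw [count, Fintype.card_subtype, Finset.card_filter]
  simp_rw [h]
  rw [← Fintype.sum_sigma' fun y i => if (c.coupling ⟨y, i⟩).1 = x then 1 else 0]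
  rw [Equiv.sum_comp c.coupling fun e => if e.1 = x then 1 else 0, Fintype.sum_sigma]
  rw [Finset.sum_eq_single x] <;> simp +contextual

/-- The Eulerian network defined by a configuration. -/
def toNetwork (c : Configuration G) : EulerianNetwork G where
  k := c.count
  k_eq_zero := c.count_eq_zero
  eulerian x := (c.sum_count x).trans (c.sum_count' x).symm

/-- The weight `Q(c)` of a configuration. -/
def weight (P : Matrix V V ℝ) (c : Configuration G) : ℝ :=
  (1 - P).det * (1 / ∏ x, ((c.deg x).factorial : ℝ)) * ∏ x, ∏ y, P x y ^ c.count x y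

end Configuration

/-- The measure `Q` on the space of configurations. -/
def configurationMeasure {V : Type*} [DecidableEq V] [Fintype V] (G : SimpleGraph V)
    (P : Matrix V V ℝ) : Measure (Configuration G) :=
  Measure.sum fun c : Configuration G => ENNReal.ofReal (c.weight P) • Measure.dirac c

end LoopNetworks

end

/-! Both laws are computed from one generating series. For a square matrix `A`, let `permAvg A n` be
`1/n!` times the sum over labellings `f` of `n` points of the permanents of `A (f i) (f j)`; it is
the complete symmetric function `h_n` of the eigenvalues. Removing a marked point from its cycle
gives Newton's identity `n h_n = ∑ tr(A ^ r) h_(n-r)`, which is `succ_mul_permAvg`. It is applied to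
`P` and to the symbolic matrix with entries `P x y * X (x, y)`, whose monomials record the jumps.

On the configuration side, `netWeight P k`, a coefficient of the symbolic series, counts couplings:
numbering the half-edges in two ways shows that the configurations projecting to `k` have total
weight `det (1 - P) * netWeight P k` (`netWeight_eq`, `tsum_ofReal_weight`). The energy forces the
eigenvalues of `P` into `(-1, 1)`, so the series at `X = 1` converges to `1 / det (1 - P)` and the
weights sum to `1`.

On the loop side, loops are sorted by their matrix of jumps `l`. A closed trajectory with `n ≥ 1`
jumps carries holding-time mass `1/n`, so the number of loops of kind `l ≠ 0` is Poisson of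
parameter `cycleWeight P l / l.degree`, independently over `l`; the parameters add up to `-log det
(1 - P)`. The Euler operator `∑ X ∂/∂X`, applied to the generating series of this compound Poisson
sum, gives exactly the coefficientwise Newton recursion of `netWeight` (`degree_mul_netWeight`,
`coeff_prod_poissonSeries`). Hence `N = k` has probability `det (1 - P) * netWeight P k`
(`measure_jumpField_eq`), as on the other side. -/

noncomputable section

namespace LoopNetworks

/-! ### Sums over permutations -/

section PermSum

variable {R V ι κ : Type*} [CommRing R] [Fintype V] [Fintype ι] [DecidableEq ι]
  [Fintype κ] [DecidableEq κ]

/-- The sum over all `f : ι → V` of the permanents of the matrices `A (f i) (f j)`. -/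
def permSum (A : Matrix V V R) (ι : Type*) [Fintype ι] [DecidableEq ι] : R :=
  ∑ f : ι → V, ∑ σ : Equiv.Perm ι, ∏ i, A (f i) (f (σ i))

/-- The variant of `permSum` in which the factor of the index `a` is taken in the matrix `M`. -/
def markedPermSum (A M : Matrix V V R) (a : ι) : R :=
  ∑ f : ι → V, ∑ σ : Equiv.Perm ι, ∏ i, (if i = a then M else A) (f i) (f (σ i))

lemma markedPermSum_self (A : Matrix V V R) (a : ι) : markedPermSum A A a = permSum A ι := by
  simp [markedPermSum, permSum]

lemma markedPermSum_equiv (A M : Matrix V V R) (e : ι ≃ κ) (a : ι) :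
    markedPermSum A M (e a) = markedPermSum A M a := by
  unfold markedPermSum
  refine Fintype.sum_equiv (e.arrowCongr (Equiv.refl V)).symm _ _ fun f => ?_
  refine Fintype.sum_equiv e.permCongr.symm _ _ fun σ => ?_
  refine Fintype.prod_equiv e.symm _ _ fun i => ?_
  simp [Equiv.symm_apply_eq, Equiv.permCongr_def]

lemma permSum_equiv (A : Matrix V V R) (e : ι ≃ κ) : permSum A κ = permSum A ι := by
  unfold permSum
  refine Fintype.sum_equiv (e.arrowCongr (Equiv.refl V)).symm _ _ fun f => ?_
  refine Fintype.sum_equiv e.permCongr.symm _ _ fun σ => ?_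
  refine Fintype.prod_equiv e.symm _ _ fun i => ?_
  simp [Equiv.permCongr_def]

/-- Inserting a point labelled `v` between `a` and `τ a` splits one factor into `A (f a) v * M v (f
(τ a))`; summing over `v` is a matrix product. -/
lemma sum_insert_eq_mul (A M : Matrix V V R) (f : ι → V) (τ : Equiv.Perm ι) (a : ι) :
    ∑ v, M v (f (τ a)) * ∏ i, A (f i) (if i = a then v else f (τ i)) =
      ∏ i, (if i = a then A * M else A) (f i) (f (τ i)) := by
  have h1 : ∀ v, ∏ i, A (f i) (if i = a then v else f (τ i)) =
      A (f a) v * ∏ i ∈ Finset.univ.erase a, A (f i) (f (τ i)) := by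
    intro v
    rw [← Finset.mul_prod_erase _ _ (Finset.mem_univ a), if_pos rfl]
    congr 1
    refine Finset.prod_congr rfl fun i hi => ?_
    rw [if_neg (Finset.ne_of_mem_erase hi)]
  have h2 : ∏ i, (if i = a then A * M else A) (f i) (f (τ i)) =
      (A * M) (f a) (f (τ a)) * ∏ i ∈ Finset.univ.erase a, A (f i) (f (τ i)) := by
    rw [← Finset.mul_prod_erase _ _ (Finset.mem_univ a), if_pos rfl]
    congr 1
    refine Finset.prod_congr rfl fun i hi => ?_
    rw [if_neg (Finset.ne_of_mem_erase hi)]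
  rw [h2, Matrix.mul_apply, Finset.sum_mul]
  refine Finset.sum_congr rfl fun v _ => ?_
  rw [h1]; ring

/-- Delete the marked point `none` from its cycle. If it is fixed, its label contributes `tr M`.
Otherwise it has a predecessor `a`, and summing over its label merges its factor with that of `a`,
so the mark moves to `a` and `M` becomes `A * M`. -/
lemma markedPermSum_option (A M : Matrix V V R) :
    markedPermSum A M (none : Option ι) =
      M.trace * permSum A ι + ∑ a : ι, markedPermSum A (A * M) a := by
  have h : markedPermSum A M (none : Option ι) = ∑ v : V, ∑ f : ι → V, ∑ i : Option ι,
      ∑ τ : Equiv.Perm ι, (M v ((i.elim v f)) *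
        ∏ j, A (f j) (if some (τ j) = i then v else f (τ j))) := by
    unfold markedPermSum
    rw [← Fintype.sum_prod_type' (f := fun (v : V) (f : ι → V) => ∑ i : Option ι,
      ∑ τ : Equiv.Perm ι, (M v ((i.elim v f)) *
        ∏ j, A (f j) (if some (τ j) = i then v else f (τ j))))]
    refine Fintype.sum_equiv (Equiv.piOptionEquivProd (β := fun _ : Option ι => V)) _ _ fun g => ?_
    rw [← Fintype.sum_prod_type']
    refine Fintype.sum_equiv Equiv.Perm.decomposeOption _ _ fun σ => ?_
    obtain ⟨⟨i, τ⟩, rfl⟩ := Equiv.Perm.decomposeOption.symm.surjective σ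
    rw [Equiv.apply_symm_apply, Fintype.prod_option]
    congr 1
    · cases i <;> simp [Equiv.piOptionEquivProd]
    · refine Finset.prod_congr rfl fun j _ => ?_
      simp only [reduceCtorEq, if_false, Equiv.Perm.decomposeOption_symm_apply, Equiv.Perm.mul_apply,
        Equiv.optionCongr_apply, Option.map_some, Equiv.piOptionEquivProd, Equiv.coe_fn_mk]
      split_ifs with h
      · rw [h, Equiv.swap_apply_right]
      · rw [Equiv.swap_apply_of_ne_of_ne (by simp) h]
  rw [h]
  simp_rw [Fintype.sum_option, Finset.sum_add_distrib]
  congr 1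
  · simp only [Option.elim_none, reduceCtorEq, if_false, Matrix.trace, Matrix.diag, permSum,
      Finset.mul_sum, Finset.sum_mul]
    rw [Finset.sum_comm]
    refine Finset.sum_congr rfl fun f _ => ?_
    rw [Finset.sum_comm]
  · unfold markedPermSum
    simp_rw [← sum_insert_eq_mul]
    rw [Finset.sum_comm, Finset.sum_comm (γ := ι)]
    refine Finset.sum_congr rfl fun f _ => ?_
    -- Index by the predecessor `a` of the deleted point instead of its image `b = τ a`.
    have h3 : ∀ F : V → ι → Equiv.Perm ι → R, ∑ v, ∑ b, ∑ τ : Equiv.Perm ι, F v b τ =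
        ∑ a, ∑ τ : Equiv.Perm ι, ∑ v, F v (τ a) τ := by
      intro F
      calc ∑ v, ∑ b, ∑ τ, F v b τ = ∑ v, ∑ τ, ∑ b, F v b τ :=
            Finset.sum_congr rfl fun v _ => Finset.sum_comm
        _ = ∑ v, ∑ τ : Equiv.Perm ι, ∑ a, F v (τ a) τ :=
            Finset.sum_congr rfl fun v _ => Finset.sum_congr rfl fun τ _ =>
              (Equiv.sum_comp τ fun b => F v b τ).symm
        _ = ∑ a, ∑ τ, ∑ v, F v (τ a) τ := by
            rw [Finset.sum_comm]
            simp_rw [Finset.sum_comm (γ := V)]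
            rw [Finset.sum_comm]
    rw [h3]
    simp

/-- The sum over `f : Fin n → V` of the permanents of the matrices `A (f i) (f j)`, divided
by `n!`. -/
def permAvg [Algebra ℚ R] (A : Matrix V V R) (n : ℕ) : R :=
  ((n.factorial : ℚ)⁻¹) • permSum A (Fin n)

lemma permAvg_zero [Algebra ℚ R] (A : Matrix V V R) : permAvg A 0 = 1 := by
  simp [permAvg, permSum]

/-- Iterating the deletion unrolls the marked cycle: `p.1 + 1` is its length and `permAvg A p.2`
accounts for the remaining points. The matrix `M` stays general because each step replaces it by `A
* M`. -/
lemma markedPermSum_option_fin [Algebra ℚ R] [DecidableEq V] (A : Matrix V V R) (n : ℕ) :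
    ∀ M : Matrix V V R, ((n.factorial : ℚ)⁻¹) • markedPermSum A M (none : Option (Fin n)) =
      ∑ p ∈ Finset.HasAntidiagonal.antidiagonal n, (A ^ p.1 * M).trace * permAvg A p.2 := by
  induction n with
  | zero =>
    intro M
    simp [markedPermSum_option, permAvg]
  | succ n ih =>
    intro M
    -- By relabelling, all positions of the mark are equivalent; the resulting factor `n + 1` turns
    -- `1/(n+1)!` into `1/n!`.
    have h : ∀ a : Fin (n + 1), markedPermSum A (A * M) a =
        markedPermSum A (A * M) (none : Option (Fin n)) := by
      intro a
      have := markedPermSum_equiv A (A * M)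
        ((finSuccEquiv n).trans (Equiv.swap none (finSuccEquiv n a))) a
      rw [← this]; simp
    rw [markedPermSum_option, Finset.sum_congr rfl fun a _ => h a, Finset.Nat.antidiagonal_succ,
      Finset.sum_cons, Finset.sum_map, smul_add]
    congr 1
    · simp [permAvg]
    · have h' := ih (A * M)
      simp only [Function.Embedding.prodMap, Function.Embedding.coeFn_mk, Prod.map,
        Function.Embedding.refl_apply, Nat.succ_eq_add_one, pow_succ, mul_assoc]
      rw [← h', Finset.sum_const, Finset.card_univ, Fintype.card_fin, ← Nat.cast_smul_eq_nsmul ℚ,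
        smul_smul, Nat.factorial_succ]
      congr 1
      push_cast
      field_simp

/-- Newton's identity, obtained by taking `M = A`, where the mark has no effect. The general ring
`R` allows its use for real and for polynomial entries. -/
lemma succ_mul_permAvg [Algebra ℚ R] [DecidableEq V] (A : Matrix V V R) (n : ℕ) :
    ((n : R) + 1) * permAvg A (n + 1) =
      ∑ p ∈ Finset.HasAntidiagonal.antidiagonal n, (A ^ (p.1 + 1)).trace * permAvg A p.2 := by
  have h := markedPermSum_option_fin A n A
  rw [markedPermSum_self, permSum_equiv A (finSuccEquiv n)] at h
  simp only [pow_succ]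
  rw [← h, permAvg, Nat.factorial_succ]
  have h1 : ((n : R) + 1) = algebraMap ℚ R (n + 1) := by simp
  rw [h1, ← Algebra.smul_def, smul_smul]
  congr 1
  push_cast
  field_simp

end PermSum

/-! ### Spectrum of the transition matrix -/

namespace Conductances

variable {V : Type*} [Fintype V] {G : SimpleGraph V} (D : Conductances G)

lemma energy_eq (f : V → ℝ) :
    D.energy f = ∑ x, D.dualityMeasure x * f x ^ 2 - ∑ x, ∑ y, D.C x y * (f x * f y) := by
  have h1 : ∑ x, ∑ y, D.C x y * f y ^ 2 = ∑ x, ∑ y, D.C x y * f x ^ 2 := by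
    rw [Finset.sum_comm]
    exact Finset.sum_congr rfl fun x _ => Finset.sum_congr rfl fun y _ => by rw [D.C_symm]
  have h2 : ∑ x, ∑ y, D.C x y * (f x - f y) ^ 2 = ∑ x, ∑ y, D.C x y * f x ^ 2 +
      ∑ x, ∑ y, D.C x y * f y ^ 2 - 2 * ∑ x, ∑ y, D.C x y * (f x * f y) := by
    simp only [Finset.mul_sum, ← Finset.sum_add_distrib, ← Finset.sum_sub_distrib]
    exact Finset.sum_congr rfl fun x _ => Finset.sum_congr rfl fun y _ => by ring
  have h3 : ∑ x, D.dualityMeasure x * f x ^ 2 =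
      ∑ x, ∑ y, D.C x y * f x ^ 2 + ∑ x, D.κ x * f x ^ 2 := by
    rw [← Finset.sum_add_distrib]
    exact Finset.sum_congr rfl fun x _ => by rw [dualityMeasure, add_mul, Finset.sum_mul]
  rw [energy, h2, h1, h3]
  ring

omit [Fintype V] in
lemma C_self (x : V) : D.C x x = 0 := D.C_eq_zero x x (G.loopless.irrefl x)

variable {D}

/-- Since `C x x = 0`, the energy of the indicator of `x` is exactly `λ_x`. -/
lemma IsTransient.dualityMeasure_pos [DecidableEq V] (hD : D.IsTransient) (x : V) :
    0 < D.dualityMeasure x := by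
  have h := hD (Pi.single x 1) (by simp)
  rw [energy_eq] at h
  have h1 : ∑ z, D.dualityMeasure z * (Pi.single x 1 : V → ℝ) z ^ 2 = D.dualityMeasure x := by
    rw [Finset.sum_eq_single x] <;> simp +contextual
  have h2 : ∑ z, ∑ y, D.C z y * ((Pi.single x 1 : V → ℝ) z * (Pi.single x 1 : V → ℝ) y) = 0 := by
    refine Finset.sum_eq_zero fun z _ => Finset.sum_eq_zero fun y _ => ?_
    by_cases hz : z = x
    · by_cases hy : y = x
      · subst hz; subst hy; simp [C_self]
      · simp [Pi.single_apply, hy]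
    · simp [Pi.single_apply, hz]
  linarith

/-- With `S = ∑ λ_x v_x ^ 2`, the energy of `v` is `(1 - e) S`, and that of `|v|` is at most `(1 +
e) S` because `C ≥ 0`. Both energies are positive. -/
lemma IsTransient.abs_eigenvalue_lt_one [DecidableEq V] (hD : D.IsTransient) {v : V → ℝ}
    (hv : v ≠ 0) {e : ℝ} (h : D.transition.mulVec v = e • v) : |e| < 1 := by
  have hC : ∀ x, ∑ y, D.C x y * v y = e * D.dualityMeasure x * v x := by
    intro x
    have hx := congrFun h x
    simp only [Matrix.mulVec, dotProduct, transition, Matrix.of_apply, Pi.smul_apply,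
      smul_eq_mul] at hx
    have hpos := hD.dualityMeasure_pos x
    have : ∑ y, D.C x y * v y = D.dualityMeasure x * ∑ y, D.C x y / D.dualityMeasure x * v y := by
      rw [Finset.mul_sum]
      exact Finset.sum_congr rfl fun y _ => by field_simp
    rw [this, hx]; ring
  have hCv : ∑ x, ∑ y, D.C x y * (v x * v y) = e * ∑ x, D.dualityMeasure x * v x ^ 2 := by
    rw [Finset.mul_sum]
    refine Finset.sum_congr rfl fun x _ => ?_
    calc ∑ y, D.C x y * (v x * v y) = v x * ∑ y, D.C x y * v y := by
          rw [Finset.mul_sum]; exact Finset.sum_congr rfl fun y _ => by ring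
      _ = _ := by rw [hC]; ring
  have hS : 0 ≤ ∑ x, D.dualityMeasure x * v x ^ 2 :=
    Finset.sum_nonneg fun x _ => mul_nonneg (hD.dualityMeasure_pos x).le (sq_nonneg _)
  have h1 := hD v hv
  rw [energy_eq, hCv] at h1
  have h2 := hD (fun x => |v x|) (fun h0 => hv (funext fun x => by simpa using congrFun h0 x))
  rw [energy_eq] at h2
  have h3 : -∑ x, ∑ y, D.C x y * (v x * v y) ≤ ∑ x, ∑ y, D.C x y * (|v x| * |v y|) := by
    rw [← Finset.sum_neg_distrib]
    refine Finset.sum_le_sum fun x _ => ?_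
    rw [← Finset.sum_neg_distrib]
    refine Finset.sum_le_sum fun y _ => ?_
    rw [← abs_mul, ← mul_neg]
    exact mul_le_mul_of_nonneg_left (neg_le_abs _) (D.C_nonneg x y)
  simp only [sq_abs] at h2
  rw [hCv] at h3
  rw [abs_lt]
  constructor <;> nlinarith

/-- Conjugating `P` by the diagonal matrix of `√λ` gives the symmetric matrix `C x y / √(λ_x λ_y)`,
to which the spectral theorem applies. -/
lemma IsTransient.exists_diagonalization [DecidableEq V] (hD : D.IsTransient) :
    ∃ (e : V → ℝ) (U W : Matrix V V ℝ), W * U = 1 ∧ U * W = 1 ∧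
      D.transition = U * Matrix.diagonal e * W ∧ ∀ i, |e i| < 1 := by
  set s : V → ℝ := fun x => √(D.dualityMeasure x) with hs
  have hs0 : ∀ x, s x ≠ 0 := fun x => (Real.sqrt_pos.2 (hD.dualityMeasure_pos x)).ne'
  have hss : ∀ x, s x * s x = D.dualityMeasure x := fun x =>
    Real.mul_self_sqrt (hD.dualityMeasure_pos x).le
  set S : Matrix V V ℝ := Matrix.of fun x y => (s x)⁻¹ * D.C x y * (s y)⁻¹ with hS
  have hH : S.IsHermitian := by
    ext x y
    simp only [hS, Matrix.conjTranspose_apply, Matrix.of_apply, star_trivial]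
    rw [D.C_symm y x]; ring
  set O : Matrix V V ℝ := (hH.eigenvectorUnitary : Matrix V V ℝ) with hO
  have hO1 : star O * O = 1 := Unitary.coe_star_mul_self _
  have hO2 : O * star O = 1 := Unitary.coe_mul_star_self _
  have hspec : S = O * Matrix.diagonal hH.eigenvalues * star O := by
    conv_lhs => rw [hH.spectral_theorem, Unitary.conjStarAlgAut_apply]
    rfl
  have hd1 : Matrix.diagonal s * Matrix.diagonal (fun x => (s x)⁻¹) = 1 := by
    rw [Matrix.diagonal_mul_diagonal, ← Matrix.diagonal_one]
    congr 1; funext x; exact mul_inv_cancel₀ (hs0 x)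
  have hd2 : Matrix.diagonal (fun x => (s x)⁻¹) * Matrix.diagonal s = 1 := by
    rw [Matrix.diagonal_mul_diagonal, ← Matrix.diagonal_one]
    congr 1; funext x; exact inv_mul_cancel₀ (hs0 x)
  have hP : D.transition = Matrix.diagonal (fun x => (s x)⁻¹) * S * Matrix.diagonal s := by
    ext x y
    rw [Matrix.mul_diagonal, Matrix.diagonal_mul]
    simp only [transition, hS, Matrix.of_apply]
    rw [← hss x]
    have := hs0 x; have := hs0 y
    field_simp
  set U := Matrix.diagonal (fun x => (s x)⁻¹) * O with hU
  set W := star O * Matrix.diagonal s with hW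
  have hWU : W * U = 1 := by
    rw [hW, hU, Matrix.mul_assoc, ← Matrix.mul_assoc _ _ O, hd1, Matrix.one_mul, hO1]
  have hUW : U * W = 1 := by
    rw [hW, hU, Matrix.mul_assoc, ← Matrix.mul_assoc O, hO2, Matrix.one_mul, hd2]
  have hPU : D.transition = U * Matrix.diagonal hH.eigenvalues * W := by
    rw [hP]
    conv_lhs => rw [hspec]
    simp only [hU, hW, Matrix.mul_assoc]
  refine ⟨hH.eigenvalues, U, W, hWU, hUW, hPU, fun i => ?_⟩
  refine hD.abs_eigenvalue_lt_one (v := U.mulVec (Pi.single i 1)) (fun h0 => ?_) ?_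
  · have : W.mulVec (U.mulVec (Pi.single i 1)) = 0 := by rw [h0, Matrix.mulVec_zero]
    rw [Matrix.mulVec_mulVec, hWU, Matrix.one_mulVec] at this
    simpa using congrFun this i
  · rw [hPU, Matrix.mulVec_mulVec, Matrix.mul_assoc, hWU, Matrix.mul_one, ← Matrix.mulVec_mulVec,
      Matrix.diagonal_mulVec_single, ← Matrix.mulVec_smul]
    congr 1
    ext j
    simp [Pi.single_apply]

end Conductances

/-! ### Power series in the eigenvalues -/

section Diagonalizable

variable {V : Type*} [Fintype V] [DecidableEq V] {P U W : Matrix V V ℝ} {e : V → ℝ}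

lemma trace_pow_of_diagonalization (hWU : W * U = 1) (hP : P = U * Matrix.diagonal e * W) (n : ℕ)
    (hUW : U * W = 1) : (P ^ n).trace = ∑ i, e i ^ n := by
  have h : P ^ n = U * Matrix.diagonal (e ^ n) * W := by
    induction n with
    | zero => simp [hUW]
    | succ n ih =>
      rw [pow_succ, ih, hP]
      calc _ = U * Matrix.diagonal (e ^ n) * (W * U) * Matrix.diagonal e * W := by
            simp only [Matrix.mul_assoc]
        _ = _ := by
            rw [hWU, Matrix.mul_one, Matrix.mul_assoc U, Matrix.diagonal_mul_diagonal]
            rfl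
  rw [h, Matrix.mul_assoc, Matrix.trace_mul_comm, Matrix.mul_assoc, hWU, Matrix.mul_one,
    Matrix.trace_diagonal]
  rfl

lemma det_one_sub_of_diagonalization (hUW : U * W = 1) (hP : P = U * Matrix.diagonal e * W) :
    (1 - P).det = ∏ i, (1 - e i) := by
  have h : 1 - P = U * Matrix.diagonal (fun i => 1 - e i) * W := by
    have : Matrix.diagonal (fun i => 1 - e i) = 1 - Matrix.diagonal e := by
      rw [← Matrix.diagonal_one, Matrix.diagonal_sub]
    rw [this, Matrix.mul_sub, Matrix.sub_mul, Matrix.mul_one, hUW, hP]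
  rw [h, Matrix.det_mul, Matrix.det_mul, mul_right_comm, ← Matrix.det_mul, hUW, Matrix.det_one,
    one_mul, Matrix.det_diagonal]

/-- The power series with coefficients `permAvg P n` is the product of the geometric series of the
eigenvalues. -/
lemma mk_permAvg_eq_prod (hWU : W * U = 1) (hUW : U * W = 1)
    (hP : P = U * Matrix.diagonal e * W) :
    PowerSeries.mk (permAvg P) = ∏ i, PowerSeries.mk fun n => e i ^ n := by
  -- The logarithmic derivative of `∏ 1/(1 - e_i t)` is the series of power sums. Newton's identity
  -- is the same differential equation for `permAvg P`, and both constant terms are `1`.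
  have hder : ∀ s : Finset V, PowerSeries.derivative ℝ (∏ i ∈ s, PowerSeries.mk fun n => e i ^ n) =
      (PowerSeries.mk fun n => ∑ i ∈ s, e i ^ (n + 1)) *
        ∏ i ∈ s, PowerSeries.mk fun n => e i ^ n := by
    intro s
    induction s using Finset.induction_on with
    | empty =>
      have : (PowerSeries.mk fun n => ∑ i ∈ (∅ : Finset V), e i ^ (n + 1)) = 0 := by ext; simp
      rw [this]
      simp
    | insert a s ha ih =>
      have h0 : PowerSeries.derivative ℝ (PowerSeries.mk fun n => e a ^ n) =
          (PowerSeries.mk fun n => e a ^ (n + 1)) * PowerSeries.mk fun n => e a ^ n := by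
        ext n
        simp only [PowerSeries.coeff_derivative, PowerSeries.coeff_mk, PowerSeries.coeff_mul]
        rw [Finset.sum_congr rfl (g := fun _ => e a ^ (n + 1))]
        · simp [mul_comm]
        · intro p hp
          rw [← pow_add, ← Finset.HasAntidiagonal.mem_antidiagonal.1 hp]; congr 1; omega
      have h1 : (PowerSeries.mk fun n => ∑ i ∈ insert a s, e i ^ (n + 1)) =
          (PowerSeries.mk fun n => e a ^ (n + 1)) +
            PowerSeries.mk fun n => ∑ i ∈ s, e i ^ (n + 1) := by
        ext n; simp [Finset.sum_insert ha]
      rw [Finset.prod_insert ha, Derivation.leibniz, ih, h0, h1, smul_eq_mul, smul_eq_mul]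
      ring
  have h := hder Finset.univ
  ext n
  rw [PowerSeries.coeff_mk]
  induction n using Nat.strong_induction_on with
  | _ n ih =>
    cases n with
    | zero => simp [permAvg_zero, PowerSeries.coeff_prod]
    | succ n =>
      have hn : ((n : ℝ) + 1) ≠ 0 := by positivity
      apply mul_left_cancel₀ hn
      rw [succ_mul_permAvg]
      have h' := congrArg (PowerSeries.coeff n) h
      rw [PowerSeries.coeff_derivative, PowerSeries.coeff_mul] at h'
      rw [mul_comm ((n : ℝ) + 1), h']
      refine Finset.sum_congr rfl fun p hp => ?_
      rw [PowerSeries.coeff_mk, trace_pow_of_diagonalization hWU hP _ hUW, ih p.2]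
      have := Finset.HasAntidiagonal.mem_antidiagonal.1 hp
      omega

/-- Evaluation at `t = 1` is justified by Cauchy products of absolutely convergent geometric series,
one eigenvalue at a time. -/
lemma hasSum_permAvg (hWU : W * U = 1) (hUW : U * W = 1) (hP : P = U * Matrix.diagonal e * W)
    (he : ∀ i, |e i| < 1) : HasSum (permAvg P) (1 - P).det⁻¹ := by
  have key : ∀ s : Finset V, ∃ a : ℕ → ℝ, Summable (fun n => ‖a n‖) ∧
      (∏ i ∈ s, PowerSeries.mk fun n => e i ^ n) = PowerSeries.mk a ∧
      ∑' n, a n = ∏ i ∈ s, (1 - e i)⁻¹ := by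
    intro s
    induction s using Finset.induction_on with
    | empty =>
      refine ⟨fun n => if n = 0 then 1 else 0, summable_of_ne_finset_zero (s := {0}) fun n hn => ?_,
        ?_, ?_⟩
      · simpa using hn
      · ext n; simp [PowerSeries.coeff_one]
      · rw [tsum_eq_single 0] <;> simp +contextual
    | insert i s hi ih =>
      obtain ⟨a, ha, ha', ha''⟩ := ih
      have h1 : Summable fun n => ‖e i ^ n‖ := by
        simpa [norm_pow] using summable_geometric_of_abs_lt_one (by simpa using he i)
      refine ⟨fun n => ∑ p ∈ Finset.HasAntidiagonal.antidiagonal n, e i ^ p.1 * a p.2,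
        summable_norm_sum_mul_antidiagonal_of_summable_norm h1 ha, ?_, ?_⟩
      · rw [Finset.prod_insert hi, ha']
        ext n
        simp [PowerSeries.coeff_mul]
      · rw [← tsum_mul_tsum_eq_tsum_sum_antidiagonal_of_summable_norm h1 ha, ha'',
          tsum_geometric_of_abs_lt_one (he i), Finset.prod_insert hi]
  obtain ⟨a, ha, ha', ha''⟩ := key Finset.univ
  have h : permAvg P = a := by
    funext n
    simpa using congrArg (PowerSeries.coeff n) ((mk_permAvg_eq_prod hWU hUW hP).trans ha')
  rw [h, det_one_sub_of_diagonalization hUW hP, ← Finset.prod_inv_distrib, ← ha'']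
  exact ha.of_norm.hasSum

end Diagonalizable

/-! ### Determinant, permanent and trace series of a transient chain -/

namespace Conductances

variable {V : Type*} [Fintype V] [DecidableEq V] {G : SimpleGraph V} {D : Conductances G}

lemma IsTransient.det_pos (hD : D.IsTransient) : 0 < (1 - D.transition).det := by
  obtain ⟨e, U, W, hWU, hUW, hP, he⟩ := hD.exists_diagonalization
  rw [det_one_sub_of_diagonalization hUW hP]
  exact Finset.prod_pos fun i _ => by have := (abs_lt.1 (he i)).2; linarith

lemma IsTransient.hasSum_permAvg (hD : D.IsTransient) :
    HasSum (permAvg D.transition) (1 - D.transition).det⁻¹ := by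
  obtain ⟨e, U, W, hWU, hUW, hP, he⟩ := hD.exists_diagonalization
  exact LoopNetworks.hasSum_permAvg hWU hUW hP he

lemma IsTransient.hasSum_trace_pow_div (hD : D.IsTransient) :
    HasSum (fun n : ℕ => (D.transition ^ (n + 1)).trace / (n + 1))
      (-Real.log (1 - D.transition).det) := by
  obtain ⟨e, U, W, hWU, hUW, hP, he⟩ := hD.exists_diagonalization
  rw [det_one_sub_of_diagonalization hUW hP, Real.log_prod (fun i _ => ?_), ← Finset.sum_neg_distrib]
  · simp_rw [trace_pow_of_diagonalization hWU hP _ hUW, Finset.sum_div]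
    exact hasSum_sum fun i _ => Real.hasSum_pow_div_log_of_abs_lt_one (he i)
  · have := (abs_lt.1 (he i)).2
    linarith

lemma IsTransient.transition_nonneg (hD : D.IsTransient) (x y : V) : 0 ≤ D.transition x y :=
  div_nonneg (D.C_nonneg x y) (hD.dualityMeasure_pos x).le

omit [DecidableEq V] in
lemma transition_eq_zero {x y : V} (h : ¬ G.Adj x y) : D.transition x y = 0 := by
  simp [transition, D.C_eq_zero x y h]

end Conductances

/-! ### Weights of networks -/

section NetWeight

variable {V ι : Type*} [Fintype ι]

/-- The matrix counting the pairs `(f i, g i)`. -/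
def stepCount (f g : ι → V) : V × V →₀ ℕ := ∑ i, Finsupp.single (f i, g i) 1

lemma degree_stepCount (f g : ι → V) : (stepCount f g).degree = Fintype.card ι := by
  simp [stepCount, map_sum]

lemma stepCount_apply [DecidableEq V] (f g : ι → V) (x y : V) :
    stepCount f g (x, y) = Fintype.card {i // f i = x ∧ g i = y} := by
  rw [stepCount, Finsupp.finsetSum_apply, Fintype.card_subtype, Finset.card_filter]
  simp [Finsupp.single_apply]

variable (P : Matrix V V ℝ)

/-- The matrix of the monomials `P x y * X (x, y)`. -/
def symbolicMatrix : Matrix V V (MvPolynomial (V × V) ℝ) :=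
  Matrix.of fun x y => MvPolynomial.monomial (Finsupp.single (x, y) 1) (P x y)

lemma prod_symbolicMatrix (f g : ι → V) :
    ∏ i, symbolicMatrix P (f i) (g i) =
      MvPolynomial.monomial (stepCount f g) (∏ i, P (f i) (g i)) := by
  classical
  unfold stepCount
  induction (Finset.univ : Finset ι) using Finset.induction_on with
  | empty => simp
  | insert a s ha ih =>
    rw [Finset.prod_insert ha, Finset.prod_insert ha, Finset.sum_insert ha, ih, symbolicMatrix,
      Matrix.of_apply, MvPolynomial.monomial_mul]

lemma prod_eq_prod_pow_stepCount [Fintype V] (f g : ι → V) :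
    ∏ i, P (f i) (g i) = ∏ x, ∏ y, P x y ^ stepCount f g (x, y) := by
  classical
  simp_rw [stepCount, Finsupp.finsetSum_apply, ← Finset.prod_pow_eq_pow_sum]
  rw [← Fintype.prod_prod_type' (f := fun x y => ∏ i, P x y ^ (Finsupp.single (f i, g i) 1 (x, y))),
    Finset.prod_comm]
  refine Finset.prod_congr rfl fun i _ => ?_
  rw [Finset.prod_eq_single (f i, g i)]
  · simp
  · intro p _ hp
    rw [Finsupp.single_eq_of_ne (by simpa using hp), pow_zero]
  · simp

variable {R : Type*} [CommRing R] [Fintype V] [DecidableEq V]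

/-- Path expansion of a matrix power, by splitting off the first step. -/
lemma pow_apply_eq_sum (A : Matrix V V R) (n : ℕ) : ∀ x y, (A ^ n) x y =
    ∑ ξ : Fin (n + 1) → V, if ξ 0 = x ∧ ξ (Fin.last n) = y then
      ∏ i : Fin n, A (ξ i.castSucc) (ξ i.succ) else 0 := by
  induction n with
  | zero =>
    intro x y
    rw [← (Equiv.funUnique (Fin 1) V).symm.sum_comp]
    simp only [pow_zero, Matrix.one_apply]
    by_cases h : x = y
    · subst h
      rw [Finset.sum_eq_single x] <;> simp +contextual
    · rw [if_neg h]
      symm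
      refine Finset.sum_eq_zero fun z _ => if_neg ?_
      simp only [Equiv.funUnique_symm_apply, uniqueElim_const]
      rintro ⟨rfl, h'⟩
      exact h h'
  | succ n ih =>
    intro x y
    symm
    rw [pow_succ', Matrix.mul_apply, ← (Fin.consEquiv fun _ : Fin (n + 2) => V).sum_comp,
      Fintype.sum_prod_type, Finset.sum_eq_single x]
    · simp_rw [ih, Finset.mul_sum]
      rw [Finset.sum_comm]
      refine Finset.sum_congr rfl fun ξ _ => ?_
      symm
      rw [Finset.sum_eq_single (ξ 0)]
      · simp only [Fin.consEquiv, Equiv.coe_fn_mk, Fin.prod_univ_succ, Fin.cons_zero,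
          Fin.castSucc_zero, Fin.cons_succ, true_and, ← Fin.succ_last, mul_ite, mul_zero,
          ← Fin.succ_castSucc]
      · intro z _ hz
        rw [if_neg (fun h => hz h.1.symm), mul_zero]
      · simp
    · intro z _ hz
      refine Finset.sum_eq_zero fun ξ _ => if_neg fun h => hz ?_
      simpa [Fin.consEquiv] using h.1
    · simp

lemma trace_pow_eq_sum (A : Matrix V V R) (n : ℕ) : (A ^ n).trace =
    ∑ ξ : {ξ : Fin (n + 1) → V // ξ (Fin.last n) = ξ 0},
      ∏ i : Fin n, A (ξ.1 i.castSucc) (ξ.1 i.succ) := by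
  simp only [Matrix.trace, Matrix.diag, pow_apply_eq_sum]
  rw [Finset.sum_comm, ← Finset.sum_subtype (Finset.univ.filter fun ξ : Fin (n + 1) → V =>
    ξ (Fin.last n) = ξ 0) (by simp) fun ξ => ∏ i : Fin n, A (ξ i.castSucc) (ξ i.succ),
    Finset.sum_filter]
  refine Finset.sum_congr rfl fun ξ _ => ?_
  rw [Finset.sum_eq_single (ξ 0)]
  · simp
  · exact fun x _ hx => if_neg fun h => hx h.1.symm
  · simp

/-- The number of steps of each kind of a trajectory. -/
def trajCount {n : ℕ} (ξ : Fin (n + 1) → V) : V × V →₀ ℕ :=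
  stepCount (fun i : Fin n => ξ i.castSucc) fun i => ξ i.succ

/-- The total weight of the closed trajectories with given numbers of steps. -/
def cycleWeight (l : V × V →₀ ℕ) : ℝ :=
  (symbolicMatrix P ^ l.degree).trace.coeff l

/-- The total weight of the configurations with given numbers of steps, up to
normalization. -/
def netWeight (k : V × V →₀ ℕ) : ℝ := (permAvg (symbolicMatrix P) k.degree).coeff k

lemma coeff_trace_pow (n : ℕ) (l : V × V →₀ ℕ) : (symbolicMatrix P ^ n).trace.coeff l =
    ∑ ξ : {ξ : Fin (n + 1) → V // ξ (Fin.last n) = ξ 0},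
      if trajCount ξ.1 = l then ∏ i : Fin n, P (ξ.1 i.castSucc) (ξ.1 i.succ) else 0 := by
  rw [trace_pow_eq_sum, MvPolynomial.coeff_sum]
  refine Finset.sum_congr rfl fun ξ _ => ?_
  rw [prod_symbolicMatrix, MvPolynomial.coeff_monomial]
  rfl

lemma coeff_permAvg (n : ℕ) (k : V × V →₀ ℕ) : (permAvg (symbolicMatrix P) n).coeff k =
    ((n.factorial : ℝ)⁻¹) * ∑ f : Fin n → V, ∑ σ : Equiv.Perm (Fin n),
      if stepCount f (f ∘ σ) = k then ∏ i, P (f i) (f (σ i)) else 0 := by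
  rw [permAvg, permSum, MvPolynomial.coeff_smul, MvPolynomial.coeff_sum, Rat.smul_def]
  push_cast
  congr 1
  refine Finset.sum_congr rfl fun f _ => ?_
  rw [MvPolynomial.coeff_sum]
  refine Finset.sum_congr rfl fun σ _ => ?_
  rw [prod_symbolicMatrix P f fun i => f (σ i), MvPolynomial.coeff_monomial]
  rfl

lemma coeff_trace_pow_eq_zero {n : ℕ} {l : V × V →₀ ℕ} (h : l.degree ≠ n) :
    (symbolicMatrix P ^ n).trace.coeff l = 0 := by
  rw [coeff_trace_pow]
  refine Finset.sum_eq_zero fun ξ _ => if_neg ?_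
  rintro rfl
  simp [trajCount, degree_stepCount] at h

lemma coeff_permAvg_eq_zero {n : ℕ} {k : V × V →₀ ℕ} (h : k.degree ≠ n) :
    (permAvg (symbolicMatrix P) n).coeff k = 0 := by
  rw [coeff_permAvg]
  refine mul_eq_zero_of_right _ (Finset.sum_eq_zero fun f _ => Finset.sum_eq_zero fun σ _ =>
    if_neg ?_)
  rintro rfl
  simp [degree_stepCount] at h

omit [DecidableEq V] in
lemma netWeight_zero : netWeight P 0 = 1 := by
  simp [netWeight, permAvg_zero]

/-- The coefficient of `X ^ k` in Newton's identity for the symbolic matrix. This recursion, with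
value `1` at `0`, determines `netWeight`. -/
lemma degree_mul_netWeight (k : V × V →₀ ℕ) : (k.degree : ℝ) * netWeight P k =
    ∑ p ∈ Finset.HasAntidiagonal.antidiagonal k,
      if p.1 = 0 then 0 else cycleWeight P p.1 * netWeight P p.2 := by
  rcases hk : k.degree with _ | n
  · rw [Finsupp.degree_eq_zero_iff] at hk
    subst hk
    simp
  · have h := congrArg (MvPolynomial.coeff k) (succ_mul_permAvg (symbolicMatrix P) n)
    have h1 : ((n : MvPolynomial (V × V) ℝ) + 1) = MvPolynomial.C ((n : ℝ) + 1) := by simp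
    rw [h1, MvPolynomial.coeff_C_mul, MvPolynomial.coeff_sum] at h
    rw [netWeight, hk, Nat.cast_succ, h]
    simp_rw [MvPolynomial.coeff_mul]
    rw [Finset.sum_comm]
    refine Finset.sum_congr rfl fun p hp => ?_
    rw [Finset.HasAntidiagonal.mem_antidiagonal] at hp
    have hd : p.1.degree + p.2.degree = n + 1 := by rw [← map_add, hp, hk]
    split_ifs with h0
    · refine Finset.sum_eq_zero fun q _ => ?_
      rw [coeff_trace_pow_eq_zero P (by simp [h0]), zero_mul]
    · have h0' : p.1.degree ≠ 0 := by rwa [Ne, Finsupp.degree_eq_zero_iff]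
      -- By homogeneity, a splitting `p` of `k` meets only the term of matching degrees; the `- 1`
      -- undoes the exponent `q.1 + 1` of the trace.
      rw [Finset.sum_eq_single (p.1.degree - 1, p.2.degree)]
      · rw [cycleWeight, netWeight, Nat.sub_add_cancel (Nat.one_le_iff_ne_zero.2 h0')]
      · intro q hq hne
        by_cases h2 : p.1.degree = q.1 + 1
        · rw [coeff_permAvg_eq_zero P (k := p.2) (n := q.2), mul_zero]
          intro h3
          exact hne (Prod.ext (by simp [h2]) h3.symm)
        · rw [coeff_trace_pow_eq_zero P h2, zero_mul]
      · intro hq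
        rw [Finset.HasAntidiagonal.mem_antidiagonal] at hq
        omega

variable {P}

lemma cycleWeight_nonneg (hP : ∀ x y, 0 ≤ P x y) (l : V × V →₀ ℕ) : 0 ≤ cycleWeight P l := by
  rw [cycleWeight, coeff_trace_pow]
  refine Finset.sum_nonneg fun ξ _ => ?_
  split_ifs
  · exact Finset.prod_nonneg fun i _ => hP _ _
  · exact le_rfl

/-- This sets every variable `X (x, y)` to `1`; nonnegativity lets it be done in `ℝ≥0∞`, where sums
can be exchanged freely. -/
lemma tsum_coeff_permAvg (hP : ∀ x y, 0 ≤ P x y) (n : ℕ) :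
    ∑' k, ENNReal.ofReal ((permAvg (symbolicMatrix P) n).coeff k) =
      ENNReal.ofReal (permAvg P n) := by
  have h0 : ∀ (f g : Fin n → V), 0 ≤ ∏ i, P (f i) (g i) := fun f g =>
    Finset.prod_nonneg fun i _ => hP _ _
  have h1 : ∀ k, ENNReal.ofReal ((permAvg (symbolicMatrix P) n).coeff k) =
      ENNReal.ofReal ((n.factorial : ℝ)⁻¹) * ∑ f : Fin n → V, ∑ σ : Equiv.Perm (Fin n),
        if k = stepCount f (f ∘ σ) then ENNReal.ofReal (∏ i, P (f i) (f (σ i))) else 0 := by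
    intro k
    rw [coeff_permAvg, ENNReal.ofReal_mul (by positivity), ENNReal.ofReal_sum_of_nonneg]
    · congr 1
      refine Finset.sum_congr rfl fun f _ => ?_
      rw [ENNReal.ofReal_sum_of_nonneg]
      · refine Finset.sum_congr rfl fun σ _ => ?_
        simp only [eq_comm (a := k)]
        split_ifs <;> simp
      · intro σ _
        split_ifs
        exacts [h0 _ _, le_rfl]
    · refine fun f _ => Finset.sum_nonneg fun σ _ => ?_
      split_ifs
      exacts [h0 _ _, le_rfl]
  simp_rw [h1]
  rw [ENNReal.tsum_mul_left, Summable.tsum_finsetSum fun _ _ => ENNReal.summable]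
  simp_rw [Summable.tsum_finsetSum fun _ _ => ENNReal.summable, tsum_ite_eq]
  rw [permAvg, permSum, Rat.smul_def]
  push_cast
  rw [ENNReal.ofReal_mul (by positivity), ENNReal.ofReal_sum_of_nonneg]
  · congr 1
    refine Finset.sum_congr rfl fun f _ => ?_
    rw [ENNReal.ofReal_sum_of_nonneg fun σ _ => h0 _ _]
  · exact fun f _ => Finset.sum_nonneg fun σ _ => h0 _ _

lemma tsum_netWeight (hP : ∀ x y, 0 ≤ P x y) :
    ∑' k, ENNReal.ofReal (netWeight P k) = ∑' n, ENNReal.ofReal (permAvg P n) := by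
  simp_rw [← tsum_coeff_permAvg hP]
  rw [ENNReal.tsum_comm]
  refine tsum_congr fun k => ?_
  rw [tsum_eq_single k.degree, netWeight]
  intro n hn
  rw [coeff_permAvg_eq_zero P hn.symm, ENNReal.ofReal_zero]

omit [DecidableEq V] in
lemma permAvg_nonneg (hP : ∀ x y, 0 ≤ P x y) (n : ℕ) : 0 ≤ permAvg P n := by
  rw [permAvg, permSum, Rat.smul_def]
  exact mul_nonneg (by positivity) (Finset.sum_nonneg fun f _ => Finset.sum_nonneg fun σ _ =>
    Finset.prod_nonneg fun i _ => hP _ _)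

end NetWeight

lemma Conductances.IsTransient.tsum_netWeight {V : Type*} [Fintype V] [DecidableEq V]
    {G : SimpleGraph V} {D : Conductances G} (hD : D.IsTransient) :
    ∑' k, ENNReal.ofReal (netWeight D.transition k) =
      ENNReal.ofReal (1 - D.transition).det⁻¹ := by
  rw [LoopNetworks.tsum_netWeight hD.transition_nonneg, ← hD.hasSum_permAvg.tsum_eq,
    ENNReal.ofReal_tsum_of_nonneg (permAvg_nonneg hD.transition_nonneg) hD.hasSum_permAvg.summable]

section

/-! ### Counting configurations -/

section Counting

variable {V : Type*} [Fintype V] [DecidableEq V]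

lemma sum_stepCount {ι : Type*} [Fintype ι] (f g : ι → V) (x : V) :
    ∑ y, stepCount f g (x, y) = Fintype.card {i // f i = x} := by
  simp_rw [stepCount_apply, Fintype.card_subtype, Finset.card_filter]
  rw [Finset.sum_comm]
  refine Finset.sum_congr rfl fun i _ => ?_
  rw [Finset.sum_eq_single (g i)] <;> simp +contextual [eq_comm]

/-- The number of permutations of the half-edges with given numbers of steps. -/
def couplingCount (m : V → ℕ) (k : V × V →₀ ℕ) : ℕ :=
  Fintype.card {σ : Equiv.Perm (Σ x, Fin (m x)) //
    stepCount Sigma.fst (fun e => (σ e).1) = k}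

lemma card_sigma_fst_fiber (m : V → ℕ) (x : V) :
    Fintype.card {e : Σ x, Fin (m x) // e.1 = x} = m x := by
  rw [Fintype.card_congr (Equiv.sigmaSubtype x), Fintype.card_fin]

/-- Relative to one such bijection `e₀`, the others correspond to the permutations preserving each
fibre over `V`. -/
lemma card_equiv_sigma {ι : Type*} [Fintype ι] [DecidableEq ι] {m : V → ℕ} {f : ι → V}
    (hf : ∀ x, Fintype.card {i // f i = x} = m x) :
    Fintype.card {e : ι ≃ Σ x, Fin (m x) // ∀ i, (e i).1 = f i} = ∏ x, (m x).factorial := by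
  have e₁ : ∀ x, {i // f i = x} ≃ Fin (m x) := fun x => Fintype.equivFinOfCardEq (hf x)
  set e₀ : ι ≃ Σ x, Fin (m x) := (Equiv.sigmaFiberEquiv f).symm.trans (Equiv.sigmaCongrRight e₁)
  have he₀ : ∀ i, (e₀ i).1 = f i := fun i => rfl
  have h := DomMulAct.stabilizer_card (Sigma.fst : (Σ x, Fin (m x)) → V)
  simp_rw [card_sigma_fst_fiber] at h
  rw [← h]
  refine Fintype.card_congr ((Equiv.equivCongr e₀ (Equiv.refl _)).subtypeEquiv fun e => ?_)
  simp only [funext_iff, Function.comp_apply, Equiv.equivCongr_apply_apply, Equiv.refl_apply]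
  refine ⟨fun h s => ?_, fun h i => ?_⟩
  · rw [h, ← he₀, Equiv.apply_symm_apply]
  · have := h (e₀ i)
    rwa [Equiv.symm_apply_apply, he₀] at this

/-- Double count of the pairs formed by a coupling of type `k` and a numbering `e` of all half-edges
by `Fin k.degree`. There are `k.degree!` numberings; conversely, a pair `(f, σ)` of type `k` arises
from the `∏ (m x)!` numberings whose vertex labels are `f`. -/
lemma factorial_mul_couplingCount {m : V → ℕ} {k : V × V →₀ ℕ} (hm : ∀ x, m x = ∑ y, k (x, y)) :
    k.degree.factorial * couplingCount m k =
      (∑ f : Fin k.degree → V, ∑ σ : Equiv.Perm (Fin k.degree),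
        if stepCount f (f ∘ σ) = k then 1 else 0) * ∏ x, (m x).factorial := by
  have hn : Fintype.card (Σ x, Fin (m x)) = Fintype.card (Fin k.degree) := by
    simp only [Fintype.card_sigma, Fintype.card_fin, hm]
    rw [Finsupp.degree_eq_sum, Fintype.sum_prod_type]
  have e₀ : Fin k.degree ≃ Σ x, Fin (m x) := (Fintype.equivOfCardEq hn).symm
  have h1 : k.degree.factorial * couplingCount m k =
      ∑ e : Fin k.degree ≃ Σ x, Fin (m x), ∑ σ : Equiv.Perm (Fin k.degree),
        if stepCount (fun i => (e i).1) (fun i => (e (σ i)).1) = k then 1 else 0 := by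
    have h2 : ∀ e : Fin k.degree ≃ Σ x, Fin (m x), (∑ σ : Equiv.Perm (Fin k.degree),
        if stepCount (fun i => (e i).1) (fun i => (e (σ i)).1) = k then 1 else 0) =
          couplingCount m k := by
      intro e
      rw [couplingCount, Fintype.card_subtype, Finset.card_filter]
      refine Fintype.sum_equiv e.permCongr _ _ fun σ => ?_
      congr 2
      unfold stepCount
      refine Fintype.sum_equiv e _ _ fun i => ?_
      simp [Equiv.permCongr_apply]
    rw [Finset.sum_congr rfl fun e _ => h2 e, Finset.sum_const, Finset.card_univ,
      Fintype.card_equiv e₀, Fintype.card_fin, smul_eq_mul]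
  have h3 : ∀ e : Fin k.degree ≃ Σ x, Fin (m x), (∑ σ : Equiv.Perm (Fin k.degree),
      if stepCount (fun i => (e i).1) (fun i => (e (σ i)).1) = k then 1 else 0) =
        ∑ f : Fin k.degree → V, if (∀ i, (e i).1 = f i) then (∑ σ : Equiv.Perm (Fin k.degree),
      if stepCount f (f ∘ σ) = k then 1 else 0) else 0 := by
    intro e
    rw [Finset.sum_eq_single fun i => (e i).1]
    · simp [Function.comp_def]
    · exact fun f _ hf => if_neg fun h => hf (funext fun i => (h i).symm)
    · simp
  rw [h1, Finset.sum_congr rfl fun e _ => h3 e, Finset.sum_comm, Finset.sum_mul]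
  refine Finset.sum_congr rfl fun f _ => ?_
  rw [← Finset.sum_filter, Finset.sum_const, ← Fintype.card_subtype, smul_eq_mul, mul_comm,
    Finset.sum_mul, Finset.sum_mul]
  refine Finset.sum_congr rfl fun σ _ => ?_
  split_ifs with h
  · have hf : ∀ x, Fintype.card {i // f i = x} = m x := fun x => by
      rw [← sum_stepCount f (f ∘ σ), h, hm]
    rw [← card_equiv_sigma hf]
    simp only [← Nat.card_eq_fintype_card]
  · simp

lemma netWeight_eq (P : Matrix V V ℝ) {m : V → ℕ} {k : V × V →₀ ℕ}
    (hm : ∀ x, m x = ∑ y, k (x, y)) :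
    netWeight P k = couplingCount m k *
      ((1 / ∏ x, ((m x).factorial : ℝ)) * ∏ x, ∏ y, P x y ^ k (x, y)) := by
  have h := congrArg (Nat.cast : ℕ → ℝ) (factorial_mul_couplingCount hm)
  push_cast at h
  have h1 : netWeight P k = ((k.degree.factorial : ℝ)⁻¹) *
      (∑ f : Fin k.degree → V, ∑ σ : Equiv.Perm (Fin k.degree),
        if stepCount f (f ∘ σ) = k then (1 : ℝ) else 0) * ∏ x, ∏ y, P x y ^ k (x, y) := by
    rw [netWeight, coeff_permAvg, mul_assoc]
    congr 1
    simp_rw [Finset.sum_mul]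
    refine Finset.sum_congr rfl fun f _ => Finset.sum_congr rfl fun σ _ => ?_
    split_ifs with hk
    · rw [one_mul]
      refine (prod_eq_prod_pow_stepCount P f (f ∘ σ)).trans ?_
      rw [hk]
    · rw [zero_mul]
  have h2 : (∏ x, ((m x).factorial : ℝ)) ≠ 0 :=
    Finset.prod_ne_zero_iff.2 fun x _ => by positivity
  have h3 : (k.degree.factorial : ℝ) ≠ 0 := by positivity
  rw [h1, eq_div_of_mul_eq h2 h.symm]
  field_simp

variable {G : SimpleGraph V}

/-- The numbers of steps of a configuration. -/
def Configuration.stepCount (c : Configuration G) : V × V →₀ ℕ :=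
  LoopNetworks.stepCount Sigma.fst fun e => (c.coupling e).1

lemma Configuration.stepCount_apply (c : Configuration G) (x y : V) :
    c.stepCount (x, y) = c.count x y := by
  rw [Configuration.stepCount, LoopNetworks.stepCount_apply, count]
  simp_rw [Fintype.card_subtype, Finset.card_filter]
  rw [Fintype.sum_sigma, Finset.sum_eq_single x]
  · simp
  · exact fun z _ hz => Finset.sum_eq_zero fun i _ => if_neg fun h => hz h.1
  · simp

/-- The step counts `k` determine the degrees as row sums, so all these configurations have the same
weight and `couplingCount` is their number. If `k` charges a non-edge, there are none and
`netWeight` vanishes with `P`. -/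
lemma tsum_ofReal_weight {P : Matrix V V ℝ} (hG : ∀ x y, ¬ G.Adj x y → P x y = 0) (k : V × V →₀ ℕ) :
    ∑' c : {c : Configuration G // c.stepCount = k}, ENNReal.ofReal (c.1.weight P) =
      ENNReal.ofReal ((1 - P).det * netWeight P k) := by
  obtain ⟨m, hm⟩ : ∃ m : V → ℕ, ∀ x, m x = ∑ y, k (x, y) := ⟨_, fun _ => rfl⟩
  rw [netWeight_eq P hm]
  by_cases hk : ∀ x y, ¬ G.Adj x y → k (x, y) = 0
  · have hw : ∀ c : {c : Configuration G // c.stepCount = k}, c.1.weight P =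
        (1 - P).det * ((1 / ∏ x, ((m x).factorial : ℝ)) * ∏ x, ∏ y, P x y ^ k (x, y)) := by
      rintro ⟨c, rfl⟩
      have h1 : ∀ x, c.deg x = m x := fun x => by
        rw [hm, ← c.sum_count]
        exact Finset.sum_congr rfl fun y _ => (c.stepCount_apply x y).symm
      simp only [Configuration.weight, Configuration.stepCount_apply, h1, mul_assoc]
    have hadj : ∀ σ : {σ : Equiv.Perm (Σ x, Fin (m x)) //
        stepCount Sigma.fst (fun e => (σ e).1) = k}, ∀ e, G.Adj e.1 (σ.1 e).1 := by
      rintro ⟨σ, hσ⟩ e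
      by_contra h
      have h0 := hk _ _ h
      replace h0 := (DFunLike.congr_fun hσ _).trans h0
      rw [stepCount_apply, Fintype.card_eq_zero_iff] at h0
      exact h0.false ⟨e, rfl, rfl⟩
    let F : {σ : Equiv.Perm (Σ x, Fin (m x)) // stepCount Sigma.fst (fun e => (σ e).1) = k} →
        {c : Configuration G // c.stepCount = k} := fun σ => ⟨⟨m, σ.1, hadj σ⟩, σ.2⟩
    have hF : Function.Bijective F := by
      constructor
      · intro σ τ h
        have h' := congrArg Subtype.val h
        simp only [F, Configuration.mk.injEq, heq_eq_eq, true_and] at h'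
        exact Subtype.ext h'
      · rintro ⟨c, hc⟩
        have h1 : m = c.deg := by
          funext x
          rw [hm, ← c.sum_count, ← hc]
          exact Finset.sum_congr rfl fun y _ => (c.stepCount_apply x y)
        subst h1
        exact ⟨⟨c.coupling, hc⟩, rfl⟩
    simp_rw [hw]
    rw [← (Equiv.ofBijective F hF).tsum_eq, tsum_fintype, Finset.sum_const, Finset.card_univ,
      nsmul_eq_mul, mul_left_comm (1 - P).det (couplingCount m k : ℝ),
      ENNReal.ofReal_mul (Nat.cast_nonneg _), ENNReal.ofReal_natCast]
    rfl
  · push Not at hk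
    obtain ⟨x, y, hxy, hk⟩ := hk
    have h0 : ∏ x, ∏ y, P x y ^ k (x, y) = 0 :=
      Finset.prod_eq_zero (Finset.mem_univ x) (Finset.prod_eq_zero (Finset.mem_univ y)
        (by rw [hG x y hxy, zero_pow hk]))
    have : IsEmpty {c : Configuration G // c.stepCount = k} := by
      refine ⟨fun c => hk ?_⟩
      rw [← c.2, Configuration.stepCount_apply, c.1.count_eq_zero _ _ hxy]
    rw [h0]
    simp

lemma configurationMeasure_apply (P : Matrix V V ℝ) (s : Set (Configuration G)) :
    configurationMeasure G P s = ∑' c : s, ENNReal.ofReal (c.1.weight P) := by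
  rw [configurationMeasure, Measure.sum_apply _ (MeasurableSpace.measurableSet_top),
    tsum_subtype s fun c => ENNReal.ofReal (c.weight P)]
  refine tsum_congr fun c => ?_
  rw [Measure.smul_apply, Measure.dirac_apply' _ (MeasurableSpace.measurableSet_top)]
  by_cases h : c ∈ s <;> simp [h]

lemma configurationMeasure_univ {P : Matrix V V ℝ} (hdet : 0 ≤ (1 - P).det)
    (hG : ∀ x y, ¬ G.Adj x y → P x y = 0) :
    configurationMeasure G P Set.univ =
      ENNReal.ofReal (1 - P).det * ∑' k, ENNReal.ofReal (netWeight P k) := by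
  rw [configurationMeasure_apply, tsum_univ fun c : Configuration G => ENNReal.ofReal (c.weight P),
    ← (Equiv.sigmaFiberEquiv Configuration.stepCount).tsum_eq, ENNReal.tsum_sigma',
    ← ENNReal.tsum_mul_left]
  refine tsum_congr fun k => ?_
  rw [← ENNReal.ofReal_mul hdet]
  exact tsum_ofReal_weight hG k

end Counting

variable {V : Type*} [Fintype V] [DecidableEq V] {G : SimpleGraph V} {D : Conductances G}

lemma Conductances.IsTransient.isProbabilityMeasure (hD : D.IsTransient) :
    IsProbabilityMeasure (configurationMeasure G D.transition) := by
  constructor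
  rw [configurationMeasure_univ hD.det_pos.le
    (fun _ _ => transition_eq_zero), hD.tsum_netWeight, ← ENNReal.ofReal_mul hD.det_pos.le,
    mul_inv_cancel₀ hD.det_pos.ne', ENNReal.ofReal_one]

lemma Conductances.IsTransient.weight_nonneg (hD : D.IsTransient) (c : Configuration G) :
    0 ≤ c.weight D.transition :=
  mul_nonneg (mul_nonneg hD.det_pos.le (by positivity)) (Finset.prod_nonneg fun x _ =>
    Finset.prod_nonneg fun y _ => pow_nonneg (hD.transition_nonneg x y) _)

end

/-! ### The loop measure -/

lemma lintegral_Ioi_exp_neg_mul {c a : ℝ} (ha : 0 < a) :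
    ∫⁻ u in Set.Ioi c, ENNReal.ofReal (Real.exp (-(u * a))) =
      ENNReal.ofReal (Real.exp (-(c * a)) / a) := by
  have h : (fun u : ℝ => Real.exp (-(u * a))) = fun u => Real.exp (-a * u) := by
    funext u; congr 1; ring
  rw [← ofReal_integral_eq_lintegral_ofReal]
  · rw [h, integral_exp_mul_Ioi (by linarith)]
    congr 1
    rw [neg_div_neg_eq]
    congr 2; ring
  · rw [h]; exact integrableOn_exp_mul_Ioi (by linarith) c
  · exact Filter.Eventually.of_forall fun u => (Real.exp_pos _).le

lemma lintegral_pi_prod {n : ℕ} {μ : Measure ℝ} [SigmaFinite μ] {f : ℝ → ℝ}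
    (hf : Integrable f μ) (hf0 : ∀ x, 0 ≤ f x) :
    ∫⁻ h : Fin n → ℝ, ENNReal.ofReal (∏ i, f (h i)) ∂Measure.pi (fun _ => μ) =
      (∫⁻ x, ENNReal.ofReal (f x) ∂μ) ^ n := by
  rw [← ofReal_integral_eq_lintegral_ofReal (Integrable.fintype_prod fun _ => hf)
      (Filter.Eventually.of_forall fun h => Finset.prod_nonneg fun i _ => hf0 _),
    integral_fintype_prod_eq_pow, Fintype.card_fin,
    ENNReal.ofReal_pow (integral_nonneg hf0),
    ofReal_integral_eq_lintegral_ofReal hf (Filter.Eventually.of_forall hf0)]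

/-- Write `exp (-s) / s` as the integral of `exp (-u s)` over `u > 1` and use Tonelli. The `n + 2`
holding times of a trajectory with `n + 1` jumps give `u ^ (-(n + 2))`, whose integral is `1 / (n +
1)`. -/
lemma holdingMeasure_univ (n : ℕ) :
    holdingMeasure (n + 1) Set.univ = ENNReal.ofReal ((n : ℝ) + 1)⁻¹ := by
  have hset : {h : Fin (n + 1 + 1) → ℝ | ∀ i, 0 < h i} =
      Set.univ.pi fun _ => Set.Ioi (0 : ℝ) := by
    ext h; simp
  have hmeas : Measurable fun p : (Fin (n + 1 + 1) → ℝ) × ℝ =>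
      ENNReal.ofReal (Real.exp (-(p.2 * ∑ i, p.1 i))) := by fun_prop
  rw [holdingMeasure, withDensity_apply _ MeasurableSet.univ, Measure.restrict_univ]
  calc ∫⁻ h in {h : Fin (n + 1 + 1) → ℝ | ∀ i, 0 < h i},
        ENNReal.ofReal (Real.exp (-∑ i, h i) / ∑ i, h i)
      = ∫⁻ h in {h : Fin (n + 1 + 1) → ℝ | ∀ i, 0 < h i}, ∫⁻ u in Set.Ioi (1 : ℝ),
          ENNReal.ofReal (Real.exp (-(u * ∑ i, h i))) := by
        refine setLIntegral_congr_fun (by rw [hset]; exact MeasurableSet.univ_pi fun _ =>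
          measurableSet_Ioi) fun h hh => ?_
        have hpos : 0 < ∑ i, h i := Finset.sum_pos (fun i _ => hh i) Finset.univ_nonempty
        rw [lintegral_Ioi_exp_neg_mul hpos, one_mul]
    _ = ∫⁻ u in Set.Ioi (1 : ℝ), ∫⁻ h in {h : Fin (n + 1 + 1) → ℝ | ∀ i, 0 < h i},
          ENNReal.ofReal (Real.exp (-(u * ∑ i, h i))) :=
        lintegral_lintegral_swap hmeas.aemeasurable
    _ = ∫⁻ u in Set.Ioi (1 : ℝ), ENNReal.ofReal (u ^ (-((n : ℝ) + 2))) := by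
        refine setLIntegral_congr_fun measurableSet_Ioi fun u hu => ?_
        have hu0 : (0 : ℝ) < u := lt_trans one_pos hu
        rw [hset, volume_pi, Measure.restrict_pi_pi]
        have h1 : ∀ h : Fin (n + 1 + 1) → ℝ, Real.exp (-(u * ∑ i, h i)) =
            ∏ i, Real.exp (-(h i * u)) := by
          intro h
          rw [← Real.exp_sum, Finset.sum_neg_distrib, ← Finset.sum_mul, mul_comm]
        simp_rw [h1]
        rw [lintegral_pi_prod (f := fun x => Real.exp (-(x * u))) _ fun x => (Real.exp_pos _).le,
          lintegral_Ioi_exp_neg_mul hu0, zero_mul, neg_zero, Real.exp_zero,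
          ← ENNReal.ofReal_pow (by positivity), Real.rpow_neg hu0.le, one_div, inv_pow]
        · congr 2
          rw [← Real.rpow_natCast]; congr 1; push_cast; ring
        · have h2 : (fun x : ℝ => Real.exp (-(x * u))) = fun x => Real.exp (-u * x) := by
            funext x; congr 1; ring
          rw [h2]
          exact integrableOn_exp_mul_Ioi (by linarith) 0
    _ = ENNReal.ofReal ((n : ℝ) + 1)⁻¹ := by
        have hlt : -((n : ℝ) + 2) < -1 := by have := n.cast_nonneg (α := ℝ); linarith
        rw [← ofReal_integral_eq_lintegral_ofReal (integrableOn_Ioi_rpow_of_lt hlt one_pos),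
          integral_Ioi_rpow_of_lt hlt one_pos, Real.one_rpow]
        · congr 1
          rw [show -((n : ℝ) + 2) + 1 = -((n : ℝ) + 1) by ring, neg_div_neg_eq, one_div]
        · filter_upwards [self_mem_ae_restrict measurableSet_Ioi] with u hu
          exact Real.rpow_nonneg (le_of_lt (lt_trans one_pos hu)) _

lemma measurable_toLoop {V : Type*} : Measurable (BasedLoop.toLoop (V := V)) := fun _ hs => hs

lemma measurableSet_loop_iff {V : Type*} {s : Set (Loop V)} : MeasurableSet s ↔
    ∀ w : ClosedTrajectory V, MeasurableSet {h | BasedLoop.toLoop ⟨w, h⟩ ∈ s} := by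
  change MeasurableSet (BasedLoop.toLoop ⁻¹' s) ↔ _
  rw [MeasurableSpace.measurableSet_iInf]
  rfl

/-! ### Jump counts of loops and the masses of their level sets -/

section Jumps

lemma count_ofFn {α : Type*} [BEq α] [LawfulBEq α] [DecidableEq α] (a : α) :
    ∀ {n : ℕ} (f : Fin n → α), (List.ofFn f).count a = ∑ i, if f i = a then 1 else 0
  | 0, f => by simp
  | n + 1, f => by
    rw [List.ofFn_succ, List.count_cons, count_ofFn a fun i => f i.succ, Fin.sum_univ_succ,
      add_comm]
    simp

variable {V : Type*} [DecidableEq V]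

lemma jumps_toLoop (w : ClosedTrajectory V) (h : Fin (w.1 + 1) → ℝ) (x y : V) :
    Loop.jumps x y (BasedLoop.toLoop ⟨w, h⟩) = if x = y then 0 else
      Fintype.card {i : Fin w.1 // w.2.1 i.castSucc = x ∧ w.2.1 i.succ = y} := by
  obtain ⟨n, ξ, hξ⟩ := w
  unfold Loop.jumps
  split_ifs with hxy
  · rfl
  cases n with
  | zero =>
    change (steps [(ξ 0, h 0)]).count (x, y) = _
    have : (ξ 0, ξ 0) ≠ (x, y) := by
      rintro h'
      rw [Prod.mk.injEq] at h'
      exact hxy (h'.1.symm.trans h'.2)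
    simp [steps, this]
  | succ n =>
    change (steps (List.ofFn fun i : Fin (n + 1) =>
      (ξ i.castSucc, if i = 0 then h 0 + h (Fin.last (n + 1)) else h i.castSucc))).count (x, y) = _
    have key : steps (List.ofFn fun i : Fin (n + 1) =>
        (ξ i.castSucc, if i = 0 then h 0 + h (Fin.last (n + 1)) else h i.castSucc)) =
        List.ofFn fun i : Fin (n + 1) => (ξ i.castSucc, ξ i.succ) := by
      refine List.ext_getElem (by simp [steps]) fun i h1 h2 => ?_
      have hi : i < n + 1 := by simpa using h2
      simp only [steps, List.getElem_zipWith, List.getElem_ofFn, List.getElem_rotate,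
        List.length_ofFn, Prod.mk.injEq, true_and]
      rcases Nat.lt_or_ge (i + 1) (n + 1) with hlt | hge
      · congr 1
        ext
        simp [Nat.mod_eq_of_lt hlt]
      · have hin : i = n := by omega
        subst hin
        -- The last cyclic step returns to the first position, which is the endpoint because the
        -- trajectory is closed.
        rw [show (⟨i, hi⟩ : Fin (i + 1)).succ = Fin.last (i + 1) from rfl, hξ]
        congr 1
        ext
        simp
    rw [key, count_ofFn, Fintype.card_subtype, Finset.card_filter]
    simp only [Prod.mk.injEq]

variable [Fintype V]

/-- The numbers of jumps of each kind made by a loop. -/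
def Loop.jumpCount (ℓ : Loop V) : V × V →₀ ℕ :=
  Finsupp.equivFunOnFinite.symm fun p => Loop.jumps p.1 p.2 ℓ

/-- The jump count does not depend on the holding times, so each section over a trajectory is
everything or empty. -/
lemma measurableSet_jumpCount (s : Set (V × V →₀ ℕ)) :
    MeasurableSet {ℓ : Loop V | ℓ.jumpCount ∈ s} := by
  rw [measurableSet_loop_iff]
  intro w
  have : ∀ h, (BasedLoop.toLoop ⟨w, h⟩).jumpCount = (BasedLoop.toLoop ⟨w, 0⟩).jumpCount := by
    intro h
    ext p
    simp only [Loop.jumpCount, Finsupp.equivFunOnFinite_symm_apply_apply, jumps_toLoop]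
  simp only [Set.mem_ofPred_eq, this, MeasurableSet.const]

variable {P : Matrix V V ℝ}

/-- A trajectory of nonzero weight never stays in place. -/
lemma jumpCount_toLoop (hP : ∀ x, P x x = 0) (w : ClosedTrajectory V) (h : Fin (w.1 + 1) → ℝ)
    (hw : ∏ i : Fin w.1, P (w.2.1 i.castSucc) (w.2.1 i.succ) ≠ 0) :
    (BasedLoop.toLoop ⟨w, h⟩).jumpCount = trajCount w.2.1 := by
  ext ⟨x, y⟩
  simp only [Loop.jumpCount, Finsupp.equivFunOnFinite_symm_apply_apply, jumps_toLoop, trajCount,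
    stepCount_apply]
  split_ifs with hxy
  · symm
    rw [Fintype.card_eq_zero_iff]
    refine ⟨fun i => hw (Finset.prod_eq_zero (Finset.mem_univ i.1) ?_)⟩
    rw [i.2.1, i.2.2, hxy, hP]
  · rfl

/-- The condition `0 ∉ s` discards the loops without jumps, whose holding-time mass is infinite. -/
lemma loopMeasure_jumpCount {s : Set (V × V →₀ ℕ)}
    (hP : ∀ x, P x x = 0) (h0 : 0 ∉ s) :
    loopMeasure P {ℓ | ℓ.jumpCount ∈ s} =
      ∑' n : ℕ, ∑ ξ : {ξ : Fin (n + 1 + 1) → V // ξ (Fin.last (n + 1)) = ξ 0},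
        Set.indicator s (fun _ => ENNReal.ofReal (∏ i : Fin (n + 1), P (ξ.1 i.castSucc) (ξ.1 i.succ)) *
          ENNReal.ofReal ((n : ℝ) + 1)⁻¹) (trajCount ξ.1) := by
  have hs := measurableSet_jumpCount s
  rw [loopMeasure, Measure.map_apply measurable_toLoop hs, basedLoopMeasure,
    Measure.sum_apply _ (measurable_toLoop hs), ENNReal.tsum_sigma']
  have hterm : ∀ w : ClosedTrajectory V,
      (ENNReal.ofReal (∏ i : Fin w.1, P (w.2.1 i.castSucc) (w.2.1 i.succ)) •
        (holdingMeasure w.1).map (Sigma.mk w)) (BasedLoop.toLoop ⁻¹' {ℓ | ℓ.jumpCount ∈ s}) =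
      Set.indicator s (fun _ => ENNReal.ofReal (∏ i : Fin w.1, P (w.2.1 i.castSucc) (w.2.1 i.succ)) *
          holdingMeasure w.1 Set.univ) (trajCount w.2.1) := by
    intro w
    have hmk : Measurable (Sigma.mk w : _ → BasedLoop V) := fun t ht =>
      MeasurableSpace.measurableSet_iInf.1 ht w
    rw [Measure.smul_apply, Measure.map_apply hmk (measurable_toLoop hs), smul_eq_mul]
    -- The two counts may differ on trajectories that step from a point to itself, but these have
    -- weight zero.
    by_cases hw : ∏ i : Fin w.1, P (w.2.1 i.castSucc) (w.2.1 i.succ) = 0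
    · rw [hw]
      by_cases h : trajCount w.2.1 ∈ s <;> simp [h]
    · have hpre : Sigma.mk w ⁻¹' (BasedLoop.toLoop ⁻¹' {ℓ : Loop V | ℓ.jumpCount ∈ s}) =
          {_h | trajCount w.2.1 ∈ s} := by
        ext h
        simp only [Set.mem_preimage, Set.mem_ofPred_eq, jumpCount_toLoop hP w h hw]
      rw [hpre]
      by_cases h : trajCount w.2.1 ∈ s <;> simp [h]
  refine (tsum_congr fun n => tsum_congr fun ξ => hterm ⟨n, ξ⟩).trans ?_
  rw [tsum_eq_zero_add' ENNReal.summable]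
  have hz : ∑' ξ : {ξ : Fin (0 + 1) → V // ξ (Fin.last 0) = ξ 0},
      Set.indicator s (fun _ => ENNReal.ofReal (∏ i : Fin 0, P (ξ.1 i.castSucc) (ξ.1 i.succ)) *
          holdingMeasure 0 Set.univ) (trajCount ξ.1) = 0 := by
    refine ENNReal.tsum_eq_zero.2 fun ξ => Set.indicator_of_notMem ?_ _
    have : trajCount ξ.1 = 0 := by simp [trajCount, stepCount]
    rwa [this]
  rw [hz, zero_add]
  refine tsum_congr fun n => ?_
  rw [tsum_fintype]
  simp only [holdingMeasure_univ]

omit [DecidableEq V] [Fintype V] in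
lemma degree_trajCount {n : ℕ} (ξ : Fin (n + 1) → V) : (trajCount ξ).degree = n := by
  simp [trajCount, degree_stepCount]

/-- Trajectories of kind `l` all have `l.degree` jumps, hence the common factor `1 / l.degree`. -/
lemma loopMeasure_jumpCount_eq (hP : ∀ x, P x x = 0) (hP0 : ∀ x y, 0 ≤ P x y)
    {l : V × V →₀ ℕ} (hl : l ≠ 0) :
    loopMeasure P {ℓ | ℓ.jumpCount = l} = ENNReal.ofReal (cycleWeight P l / l.degree) := by
  have h := loopMeasure_jumpCount (s := {l}) hP (by simpa using hl.symm)
  simp only [Set.mem_singleton_iff] at h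
  rw [h]
  obtain ⟨n, hn⟩ := Nat.exists_eq_succ_of_ne_zero (mt (Finsupp.degree_eq_zero_iff l).1 hl)
  rw [tsum_eq_single n]
  · rw [cycleWeight, hn, coeff_trace_pow, div_eq_mul_inv, Nat.cast_succ, Finset.sum_mul,
      ENNReal.ofReal_sum_of_nonneg]
    · refine Finset.sum_congr rfl fun ξ _ => ?_
      by_cases hξ : trajCount ξ.1 = l
      · rw [Set.indicator_of_mem (by simpa using hξ), if_pos hξ, ENNReal.ofReal_mul]
        exact Finset.prod_nonneg fun i _ => hP0 _ _
      · rw [Set.indicator_of_notMem (by simpa using hξ), if_neg hξ, zero_mul, ENNReal.ofReal_zero]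
    · intro ξ _
      split_ifs
      · exact mul_nonneg (Finset.prod_nonneg fun i _ => hP0 _ _) (by positivity)
      · simp
  · intro m hm
    refine Finset.sum_eq_zero fun ξ _ => Set.indicator_of_notMem ?_ _
    intro hξ
    rw [Set.mem_singleton_iff] at hξ
    rw [← hξ, degree_trajCount] at hn
    omega

lemma loopMeasure_jumpCount_ne_zero (hP : ∀ x, P x x = 0) (hP0 : ∀ x y, 0 ≤ P x y) :
    loopMeasure P {ℓ | ℓ.jumpCount ≠ 0} =
      ∑' n : ℕ, ENNReal.ofReal ((P ^ (n + 1)).trace / (n + 1)) := by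
  have h := loopMeasure_jumpCount (s := {0}ᶜ) hP (by simp)
  simp only [Set.mem_compl_iff, Set.mem_singleton_iff] at h
  refine h.trans (tsum_congr fun n => ?_)
  rw [trace_pow_eq_sum, div_eq_mul_inv, Finset.sum_mul, ENNReal.ofReal_sum_of_nonneg]
  · refine Finset.sum_congr rfl fun ξ _ => ?_
    rw [Set.indicator_of_mem, ENNReal.ofReal_mul]
    · exact Finset.prod_nonneg fun i _ => hP0 _ _
    · intro hξ
      have := congrArg Finsupp.degree (Set.mem_singleton_iff.1 hξ)
      simp [degree_trajCount] at this
  · exact fun ξ _ => mul_nonneg (Finset.prod_nonneg fun i _ => hP0 _ _) (by positivity)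

variable {G : SimpleGraph V} {D : Conductances G}

lemma Conductances.IsTransient.trace_pow_nonneg (hD : D.IsTransient) (n : ℕ) :
    0 ≤ (D.transition ^ n).trace := by
  rw [trace_pow_eq_sum]
  exact Finset.sum_nonneg fun ξ _ => Finset.prod_nonneg fun i _ => hD.transition_nonneg _ _

lemma Conductances.IsTransient.neg_log_det_nonneg (hD : D.IsTransient) :
    0 ≤ -Real.log (1 - D.transition).det :=
  hD.hasSum_trace_pow_div.nonneg fun n => div_nonneg (hD.trace_pow_nonneg _) (by positivity)

/-- The factors `1/n` turn the traces `tr (P ^ n)` into the logarithm series. In particular the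
loops that jump have finite total mass. -/
lemma Conductances.IsTransient.loopMeasure_jumpCount_ne_zero (hD : D.IsTransient) :
    loopMeasure D.transition {ℓ | ℓ.jumpCount ≠ 0} =
      ENNReal.ofReal (-Real.log (1 - D.transition).det) := by
  have h := hD.hasSum_trace_pow_div
  rw [LoopNetworks.loopMeasure_jumpCount_ne_zero
    (fun x => transition_eq_zero (G.loopless.irrefl x)) hD.transition_nonneg, ← h.tsum_eq,
    ENNReal.ofReal_tsum_of_nonneg _ h.summable]
  exact fun n => div_nonneg (hD.trace_pow_nonneg _) (by positivity)

end Jumps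

/-! ### Generating series of compound Poisson variables -/

section CompoundPoisson

variable {σ : Type*}

/-- The Euler operator on multivariate power series. -/
def eulerOp (f : MvPowerSeries σ ℝ) : MvPowerSeries σ ℝ := fun u => (u.degree : ℝ) * f u

lemma coeff_eulerOp (f : MvPowerSeries σ ℝ) (u : σ →₀ ℕ) :
    MvPowerSeries.coeff u (eulerOp f) = (u.degree : ℝ) * MvPowerSeries.coeff u f := rfl

lemma eulerOp_one : eulerOp (1 : MvPowerSeries σ ℝ) = 0 := by
  classical
  ext u
  rw [coeff_eulerOp, MvPowerSeries.coeff_one]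
  split_ifs with h <;> simp [h]

lemma eulerOp_mul (f g : MvPowerSeries σ ℝ) :
    eulerOp (f * g) = eulerOp f * g + f * eulerOp g := by
  classical
  ext u
  rw [coeff_eulerOp, map_add, MvPowerSeries.coeff_mul, MvPowerSeries.coeff_mul,
    MvPowerSeries.coeff_mul, Finset.mul_sum, ← Finset.sum_add_distrib]
  refine Finset.sum_congr rfl fun p hp => ?_
  rw [Finset.HasAntidiagonal.mem_antidiagonal] at hp
  rw [← hp, map_add, coeff_eulerOp, coeff_eulerOp]
  push_cast
  ring

/-- The probability generating series of `n • l`, for a Poisson variable `n` of parameter `r`. -/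
def poissonSeries (r : ℝ≥0) (l : σ →₀ ℕ) : MvPowerSeries σ ℝ :=
  fun u => (poissonMeasure r).real {n | n • l = u}

lemma coeff_poissonSeries (r : ℝ≥0) (l u : σ →₀ ℕ) :
    MvPowerSeries.coeff u (poissonSeries r l) = (poissonMeasure r).real {n | n • l = u} := rfl

lemma coeff_poissonSeries_nonneg (r : ℝ≥0) (l u : σ →₀ ℕ) :
    0 ≤ MvPowerSeries.coeff u (poissonSeries r l) := measureReal_nonneg

lemma nsmul_injective_of_ne_zero {l : σ →₀ ℕ} (hl : l ≠ 0) :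
    Function.Injective fun n : ℕ => n • l := by
  intro m n h
  have h' := congrArg Finsupp.degree h
  simp only [map_nsmul, smul_eq_mul] at h'
  exact Nat.eq_of_mul_eq_mul_right (Nat.pos_of_ne_zero (mt (Finsupp.degree_eq_zero_iff l).1 hl)) h'

lemma coeff_poissonSeries_nsmul (r : ℝ≥0) {l : σ →₀ ℕ} (hl : l ≠ 0) (j : ℕ) :
    MvPowerSeries.coeff (j • l) (poissonSeries r l) = Real.exp (-r) * r ^ j / j.factorial := by
  have h : {n : ℕ | n • l = j • l} = {j} := by
    ext n
    exact (nsmul_injective_of_ne_zero hl).eq_iff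
  rw [coeff_poissonSeries, h, poissonMeasure_real_singleton]

lemma coeff_poissonSeries_eq_zero (r : ℝ≥0) {l u : σ →₀ ℕ} (h : ∀ n : ℕ, n • l ≠ u) :
    MvPowerSeries.coeff u (poissonSeries r l) = 0 := by
  have h' : {n : ℕ | n • l = u} = ∅ := Set.eq_empty_of_forall_notMem h
  rw [coeff_poissonSeries, h', measureReal_empty]

/-- The series is `exp (r (X ^ l - 1))`, and the Euler operator multiplies `X ^ l` by `l.degree`. -/
lemma eulerOp_poissonSeries (r : ℝ≥0) {l : σ →₀ ℕ} (hl : l ≠ 0) :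
    eulerOp (poissonSeries r l) =
      MvPowerSeries.monomial l ((l.degree : ℝ) * r) * poissonSeries r l := by
  classical
  ext u
  rw [coeff_eulerOp, MvPowerSeries.coeff_monomial_mul]
  by_cases h : ∃ n : ℕ, n • l = u
  · obtain ⟨n, rfl⟩ := h
    cases n with
    | zero => rw [if_neg]
              · simp
              · rw [zero_smul]
                exact fun h => hl (le_antisymm h bot_le)
    | succ n =>
      rw [if_pos (by rw [succ_nsmul]; exact le_add_self),
        show (n + 1) • l - l = n • l by rw [succ_nsmul, add_tsub_cancel_right],
        coeff_poissonSeries_nsmul r hl, coeff_poissonSeries_nsmul r hl, map_nsmul,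
        Nat.factorial_succ]
      have := n.factorial_ne_zero
      push_cast [smul_eq_mul]
      field_simp
      ring
  · push Not at h
    rw [coeff_poissonSeries_eq_zero r h, mul_zero]
    split_ifs with hlu
    · rw [coeff_poissonSeries_eq_zero r, mul_zero]
      intro n hn
      apply h (n + 1)
      rw [succ_nsmul, hn, tsub_add_cancel_of_le hlu]
    · rfl

lemma eulerOp_prod_poissonSeries (r : (σ →₀ ℕ) → ℝ≥0) (F : Finset (σ →₀ ℕ)) (hF : 0 ∉ F) :
    eulerOp (∏ l ∈ F, poissonSeries (r l) l) =
      (∑ l ∈ F, MvPowerSeries.monomial l ((l.degree : ℝ) * r l)) *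
        ∏ l ∈ F, poissonSeries (r l) l := by
  classical
  induction F using Finset.induction_on with
  | empty => simp [eulerOp_one]
  | insert a s ha ih =>
    rw [Finset.mem_insert, not_or] at hF
    rw [Finset.prod_insert ha, Finset.sum_insert ha, eulerOp_mul, ih hF.2,
      eulerOp_poissonSeries _ (Ne.symm hF.1)]
    ring

lemma degree_mul_coeff_prod_poissonSeries [DecidableEq σ] (r : (σ →₀ ℕ) → ℝ≥0)
    (F : Finset (σ →₀ ℕ)) (hF : 0 ∉ F) (k : σ →₀ ℕ) :
    (k.degree : ℝ) * MvPowerSeries.coeff k (∏ l ∈ F, poissonSeries (r l) l) =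
      ∑ p ∈ Finset.HasAntidiagonal.antidiagonal k, if p.1 ∈ F then (p.1.degree : ℝ) * r p.1 *
        MvPowerSeries.coeff p.2 (∏ l ∈ F, poissonSeries (r l) l) else 0 := by
  rw [← coeff_eulerOp, eulerOp_prod_poissonSeries r F hF, MvPowerSeries.coeff_mul]
  refine Finset.sum_congr rfl fun p _ => ?_
  rw [map_sum]
  simp_rw [MvPowerSeries.coeff_monomial]
  rw [Finset.sum_ite_eq]
  split_ifs <;> simp

lemma coeff_zero_prod_poissonSeries (r : (σ →₀ ℕ) → ℝ≥0) (F : Finset (σ →₀ ℕ)) (hF : 0 ∉ F) :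
    MvPowerSeries.coeff 0 (∏ l ∈ F, poissonSeries (r l) l) =
      Real.exp (-∑ l ∈ F, (r l : ℝ)) := by
  rw [MvPowerSeries.coeff_zero_eq_constantCoeff_apply, map_prod, ← Finset.sum_neg_distrib,
    Real.exp_sum]
  refine Finset.prod_congr rfl fun l hl => ?_
  have h := coeff_poissonSeries_nsmul (r l) (l := l) (by rintro rfl; exact hF hl) 0
  simpa using h

end CompoundPoisson

/-! ### Compound Poisson coefficients and network weights -/

section NetWeight

variable {V : Type*} [Fintype V] [DecidableEq V] {P : Matrix V V ℝ}

/-- Both sides satisfy the recursion of `degree_mul_netWeight`, with initial value `exp (-∑ r)`.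
Kinds not below `k` cannot contribute to coefficients at `k' ≤ k`, so a finite product suffices. -/
lemma coeff_prod_poissonSeries {r : (V × V →₀ ℕ) → ℝ≥0} {F : Finset (V × V →₀ ℕ)}
    {k : V × V →₀ ℕ} (hF : ∀ l, l ∈ F ↔ l ≤ k ∧ l ≠ 0)
    (hr : ∀ l ∈ F, (l.degree : ℝ) * r l = cycleWeight P l) : ∀ k' ≤ k,
    MvPowerSeries.coeff k' (∏ l ∈ F, poissonSeries (r l) l) =
      Real.exp (-∑ l ∈ F, (r l : ℝ)) * netWeight P k' := by
  have h0 : 0 ∉ F := fun h => ((hF 0).1 h).2 rfl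
  suffices h : ∀ n : ℕ, ∀ k' ≤ k, k'.degree = n →
      MvPowerSeries.coeff k' (∏ l ∈ F, poissonSeries (r l) l) =
        Real.exp (-∑ l ∈ F, (r l : ℝ)) * netWeight P k' from fun k' hk' => h _ k' hk' rfl
  intro n
  induction n using Nat.strong_induction_on with
  | _ n ih =>
    intro k' hk' hn
    by_cases hz : k' = 0
    · rw [hz, coeff_zero_prod_poissonSeries r F h0, netWeight_zero, mul_one]
    · have hd : (k'.degree : ℝ) ≠ 0 := by
        rw [Nat.cast_ne_zero]
        exact mt (Finsupp.degree_eq_zero_iff k').1 hz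
      apply mul_left_cancel₀ hd
      rw [degree_mul_coeff_prod_poissonSeries r F h0, mul_left_comm, degree_mul_netWeight,
        Finset.mul_sum]
      refine Finset.sum_congr rfl fun p hp => ?_
      rw [Finset.HasAntidiagonal.mem_antidiagonal] at hp
      by_cases hp0 : p.1 = 0
      · rw [if_neg (by rw [hp0]; exact h0), if_pos hp0, mul_zero]
      · have hp1 : p.1 ≤ k := (le_self_add.trans hp.le).trans hk'
        have hp2 : p.2 ≤ k := (le_add_self.trans hp.le).trans hk'
        have hmem : p.1 ∈ F := (hF _).2 ⟨hp1, hp0⟩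
        have hlt : p.2.degree < n := by
          have h1 := congrArg Finsupp.degree hp
          rw [map_add] at h1
          have h2 := mt (Finsupp.degree_eq_zero_iff p.1).1 hp0
          omega
        rw [if_pos hmem, if_neg hp0, hr _ hmem, ih _ hlt _ hp2 rfl]
        ring

end NetWeight

/-! ### Law of the jump field -/

namespace IsPoissonProcess

variable {Ω E : Type*} [MeasurableSpace Ω] [MeasurableSpace E] {L : Ω → Measure E}
  {ν : Measure E} {μ : Measure Ω}

lemma measure_mem_image (hL : IsPoissonProcess L ν μ) {A : Set E} (hA : MeasurableSet A)
    (hν : ν A ≠ ∞) (s : Set ℕ) :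
    μ {ω | L ω A ∈ (Nat.cast : ℕ → ℝ≥0∞) '' s} = poissonMeasure (ν A).toNNReal s := by
  have hs : MeasurableSet ((Nat.cast : ℕ → ℝ≥0∞) '' s) := (s.to_countable.image _).measurableSet
  rw [(hL.hasLaw A hA hν).measure_eq (p := fun x => x ∈ (Nat.cast : ℕ → ℝ≥0∞) '' s) hs]
  change Measure.map _ _ ((Nat.cast : ℕ → ℝ≥0∞) '' s) = _
  rw [Measure.map_apply measurable_from_top hs,
    Set.preimage_image_eq s fun m n h => by exact_mod_cast h]

lemma ae_exists_natCast (hL : IsPoissonProcess L ν μ) {A : Set E} (hA : MeasurableSet A)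
    (hν : ν A ≠ ∞) : ∀ᵐ ω ∂μ, ∃ n : ℕ, L ω A = n := by
  have hX := hL.hasLaw A hA hν
  refine ae_of_ae_map hX.aemeasurable (p := fun x : ℝ≥0∞ => ∃ n : ℕ, x = n) ?_
  rw [hX.map_eq, ae_map_iff measurable_from_top.aemeasurable]
  · exact Filter.Eventually.of_forall fun n => ⟨n, rfl⟩
  · have : {x : ℝ≥0∞ | ∃ n : ℕ, x = n} = Set.range (Nat.cast : ℕ → ℝ≥0∞) := by
      ext x; simp [eq_comm]
    rw [this]
    exact (Set.countable_range _).measurableSet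

lemma iIndepFun_of_disjoint (hL : IsPoissonProcess L ν μ) {ι : Type*} [Fintype ι] {A : ι → Set E}
    (hA : ∀ i, MeasurableSet (A i)) (hdisj : Pairwise fun i j => Disjoint (A i) (A j)) :
    iIndepFun (fun i ω => L ω (A i)) μ := by
  have e := Fintype.equivFin ι
  have h := hL.indep (Fintype.card ι) (fun i => A (e.symm i)) (fun i => hA _)
    fun i j hij => hdisj (e.symm.injective.ne hij)
  simpa using h.precomp e.injective

end IsPoissonProcess

/-! ### The jump field in terms of the numbers of loops of each kind -/

section JumpField

variable {V : Type*} [Fintype V] [DecidableEq V]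

lemma jumpField_eq_tsum (Λ : Measure (Loop V)) {x y : V} :
    jumpField Λ x y = ∑' l : V × V →₀ ℕ, (l (x, y) : ℝ≥0∞) * Λ {ℓ | ℓ.jumpCount = l} := by
  let _ : MeasurableSpace (V × V →₀ ℕ) := ⊤
  have hm : Measurable (Loop.jumpCount (V := V)) := fun s _ => measurableSet_jumpCount s
  calc jumpField Λ x y = ∫⁻ ℓ, ((ℓ.jumpCount (x, y) : ℕ) : ℝ≥0∞) ∂Λ := rfl
    _ = ∫⁻ l, (l (x, y) : ℝ≥0∞) ∂(Λ.map Loop.jumpCount) := by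
        rw [lintegral_map measurable_from_top hm]
    _ = _ := by
        rw [lintegral_countable']
        refine tsum_congr fun l => ?_
        rw [Measure.map_apply hm MeasurableSpace.measurableSet_top]
        rfl

/-- If the numbers of loops of each nonzero kind are finite, the event that the jump field is equal
to `k` is described by the numbers of loops of kinds at most `k`. -/
lemma jumpField_eq_iff {Λ : Measure (Loop V)} {k : V × V →₀ ℕ}
    (hΛ : ∀ l : V × V →₀ ℕ, l ≠ 0 → ∃ n : ℕ, Λ {ℓ | ℓ.jumpCount = l} = n)
    {F : Finset (V × V →₀ ℕ)} (hF : ∀ l, l ∈ F ↔ l ≤ k ∧ l ≠ 0) :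
    (∀ x y, jumpField Λ x y = k (x, y)) ↔ Λ {ℓ | ¬ ℓ.jumpCount ≤ k} = 0 ∧
      ∃ g ∈ Finset.finsuppAntidiag F k, ∀ l ∈ F,
        Λ {ℓ | ℓ.jumpCount = l} ∈ (Nat.cast : ℕ → ℝ≥0∞) '' {n | n • l = g l} := by
  have hΛ' : ∀ l : V × V →₀ ℕ, ∃ n : ℕ, l ≠ 0 → Λ {ℓ | ℓ.jumpCount = l} = n := by
    intro l
    by_cases hl : l = 0
    · exact ⟨0, fun h => (h hl).elim⟩
    · obtain ⟨n, hn⟩ := hΛ l hl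
      exact ⟨n, fun _ => hn⟩
  choose N hN using hΛ'
  have hsum : (∀ l, ¬ l ≤ k → Λ {ℓ | ℓ.jumpCount = l} = 0) →
      ∀ x y, jumpField Λ x y = ((∑ l ∈ F, N l • l) (x, y) : ℕ) := by
    intro h x y
    rw [jumpField_eq_tsum, tsum_eq_sum (s := F), Finsupp.finsetSum_apply, Nat.cast_sum]
    · refine Finset.sum_congr rfl fun l hl => ?_
      rw [hN l ((hF l).1 hl).2, Finsupp.smul_apply, smul_eq_mul, Nat.cast_mul, mul_comm]
    · intro l hl
      by_cases hl0 : l = 0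
      · simp [hl0]
      · rw [h l fun hlk => hl ((hF l).2 ⟨hlk, hl0⟩), mul_zero]
  constructor
  · intro h
    have hle : ∀ l, ¬ l ≤ k → Λ {ℓ | ℓ.jumpCount = l} = 0 := by
      intro l hl
      have hl0 : l ≠ 0 := fun h0 => hl (h0 ▸ bot_le)
      rw [hN l hl0, Nat.cast_eq_zero]
      -- A single loop of kind `l` already contributes `l (x, y)` to the field at `(x, y)`, which
      -- forces `l ≤ k`.
      by_contra hne
      apply hl
      rintro ⟨x, y⟩
      have h1 : (l (x, y) : ℝ≥0∞) * Λ {ℓ | ℓ.jumpCount = l} ≤ k (x, y) := by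
        rw [← h x y, jumpField_eq_tsum]
        exact ENNReal.le_tsum (f := fun l : V × V →₀ ℕ =>
          (l (x, y) : ℝ≥0∞) * Λ {ℓ | ℓ.jumpCount = l}) l
      rw [hN l hl0, ← Nat.cast_mul, Nat.cast_le] at h1
      exact (Nat.le_mul_of_pos_right _ (Nat.pos_of_ne_zero hne)).trans h1
    have hk : ∑ l ∈ F, N l • l = k := by
      ext ⟨x, y⟩
      have := (hsum hle x y).symm.trans (h x y)
      exact_mod_cast this
    -- The witness `g l` is the total contribution of the loops of kind `l`; such `g` range over the
    -- finite set of decompositions of `k`.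
    refine ⟨?_, Finsupp.onFinset F (fun l => if l ∈ F then N l • l else 0) ?_, ?_, ?_⟩
    · have : {ℓ : Loop V | ¬ ℓ.jumpCount ≤ k} ⊆
          ⋃ l : {l : V × V →₀ ℕ // ¬ l ≤ k}, {ℓ | ℓ.jumpCount = l.1} := fun ℓ hℓ =>
        Set.mem_iUnion.2 ⟨⟨ℓ.jumpCount, hℓ⟩, rfl⟩
      exact measure_mono_null this (measure_iUnion_null fun l => hle l.1 l.2)
    · intro l hl
      by_contra h'
      exact hl (if_neg h')
    · rw [Finset.mem_finsuppAntidiag]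
      refine ⟨?_, Finsupp.support_onFinset_subset⟩
      rw [← hk]
      exact Finset.sum_congr rfl fun l hl => by simp [hl]
    · intro l hl
      exact ⟨N l, by simp [hl], (hN l ((hF l).1 hl).2).symm⟩
  · rintro ⟨hB, g, hg, h⟩
    rw [Finset.mem_finsuppAntidiag] at hg
    have hle : ∀ l, ¬ l ≤ k → Λ {ℓ | ℓ.jumpCount = l} = 0 := fun l hl =>
      measure_mono_null (fun ℓ (hℓ : ℓ.jumpCount = l) => by
        change ¬ ℓ.jumpCount ≤ k
        rwa [hℓ]) hB
    intro x y
    rw [hsum hle, ← hg.1]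
    congr 2
    refine Finset.sum_congr rfl fun l hl => ?_
    obtain ⟨n, hn, hn'⟩ := h l hl
    rw [hN l ((hF l).1 hl).2, Nat.cast_inj] at hn'
    rw [← hn', hn]

end JumpField

/-! ### Point probabilities of the jump field -/

section Law

variable {V : Type*} [Fintype V] [DecidableEq V] {G : SimpleGraph V} {D : Conductances G}
  {Ω : Type*} [MeasurableSpace Ω] {μ : Measure Ω}
  {L : Ω → Measure (Loop V)}

lemma Conductances.IsTransient.loopMeasure_ne_top (hD : D.IsTransient) {A : Set (Loop V)}
    (hA : ∀ ℓ ∈ A, ℓ.jumpCount ≠ 0) : loopMeasure D.transition A ≠ ∞ :=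
  ne_top_of_le_ne_top (by rw [hD.loopMeasure_jumpCount_ne_zero]; exact ENNReal.ofReal_ne_top)
    (measure_mono (t := {ℓ : Loop V | ℓ.jumpCount ≠ 0}) fun ℓ hℓ => hA ℓ hℓ)

/-- Sum over the decompositions `g` of `k` the probability that no loop has a kind outside `Iic k`
and that each kind `l` contributes `g l`. Independence makes this a coefficient of a product of
Poisson series. -/
lemma measure_jumpField_eq (hD : D.IsTransient)
    (hL : IsPoissonProcess L (loopMeasure D.transition) μ) (k : V × V →₀ ℕ) :
    μ {ω | ∀ x y, jumpField (L ω) x y = k (x, y)} =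
      ENNReal.ofReal ((1 - D.transition).det * netWeight D.transition k) := by
  set ν := loopMeasure D.transition with hν
  set F : Finset (V × V →₀ ℕ) := (Finset.Iic k).erase 0 with hFdef
  have hF : ∀ l, l ∈ F ↔ l ≤ k ∧ l ≠ 0 := fun l => by
    rw [hFdef, Finset.mem_erase, Finset.mem_Iic, and_comm]
  set A : Option F → Set (Loop V) := fun i =>
    i.elim {ℓ | ¬ ℓ.jumpCount ≤ k} fun l => {ℓ | ℓ.jumpCount = l.1} with hAdef
  have hAm : ∀ i, MeasurableSet (A i) := by
    rintro (_ | l)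
    · exact measurableSet_jumpCount {l | ¬ l ≤ k}
    · exact measurableSet_jumpCount {l.1}
  have hAfin : ∀ i, ν (A i) ≠ ∞ := by
    rintro (_ | l)
    · exact hD.loopMeasure_ne_top fun ℓ (hℓ : ¬ ℓ.jumpCount ≤ k) h0 => hℓ (h0 ▸ bot_le)
    · exact hD.loopMeasure_ne_top fun ℓ (hℓ : ℓ.jumpCount = l.1) => hℓ ▸ ((hF l.1).1 l.2).2
  have hAd : Pairwise fun i j => Disjoint (A i) (A j) := by
    rintro (_ | l) (_ | l') hne
    · exact (hne rfl).elim
    · exact Set.disjoint_left.2 fun ℓ (h : ¬ ℓ.jumpCount ≤ k) (h' : ℓ.jumpCount = l'.1) =>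
        h (h' ▸ ((hF _).1 l'.2).1)
    · exact Set.disjoint_left.2 fun ℓ (h' : ℓ.jumpCount = l.1) (h : ¬ ℓ.jumpCount ≤ k) =>
        h (h' ▸ ((hF _).1 l.2).1)
    · exact Set.disjoint_left.2 fun ℓ (h : ℓ.jumpCount = l.1) (h' : ℓ.jumpCount = l'.1) =>
        hne (congrArg some (Subtype.ext (h.symm.trans h')))
  have hind := hL.iIndepFun_of_disjoint hAm hAd
  set r : (V × V →₀ ℕ) → ℝ≥0 := fun l => (ν {ℓ | ℓ.jumpCount = l}).toNNReal with hr
  have hPself : ∀ x, D.transition x x = 0 := fun x =>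
    Conductances.transition_eq_zero (G.loopless.irrefl x)
  have hrF : ∀ l ∈ F, (l.degree : ℝ) * r l = cycleWeight D.transition l := by
    intro l hl
    have hl0 := ((hF l).1 hl).2
    have hd : (l.degree : ℝ) ≠ 0 := by
      rw [Nat.cast_ne_zero]
      exact mt (Finsupp.degree_eq_zero_iff l).1 hl0
    have : (r l : ℝ) = cycleWeight D.transition l / l.degree := by
      change (ν {ℓ | ℓ.jumpCount = l}).toReal = _
      rw [hν, loopMeasure_jumpCount_eq hPself hD.transition_nonneg hl0, ENNReal.toReal_ofReal]
      exact div_nonneg (cycleWeight_nonneg hD.transition_nonneg l) (Nat.cast_nonneg _)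
    rw [this]
    field_simp
  -- The sets `A i` partition the loops that jump; this turns the product of all the exponential
  -- factors into `det (1 - P)`.
  have htot : ((ν (A none)).toNNReal : ℝ) + ∑ l ∈ F, (r l : ℝ) =
      -Real.log (1 - D.transition).det := by
    have hU : {ℓ : Loop V | ℓ.jumpCount ≠ 0} = ⋃ i, A i := by
      ext ℓ
      simp only [Set.mem_iUnion, Set.mem_ofPred_eq]
      constructor
      · intro h
        by_cases hk : ℓ.jumpCount ≤ k
        · exact ⟨some ⟨ℓ.jumpCount, (hF _).2 ⟨hk, h⟩⟩, rfl⟩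
        · exact ⟨none, hk⟩
      · rintro ⟨_ | l, hℓ⟩
        · exact fun h0 => hℓ (h0 ▸ bot_le)
        · exact fun h0 => ((hF _).1 l.2).2 (hℓ.symm.trans h0)
    have h1 := hD.loopMeasure_jumpCount_ne_zero
    rw [hU, measure_iUnion hAd hAm, tsum_fintype, Fintype.sum_option] at h1
    have h2 := congrArg ENNReal.toReal h1
    rw [ENNReal.toReal_add (hAfin none) (ENNReal.sum_ne_top.2 fun l _ => hAfin (some l)),
      ENNReal.toReal_sum fun l _ => hAfin (some l), ENNReal.toReal_ofReal] at h2
    · rw [← h2, ← Finset.sum_coe_sort F]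
      rfl
    · exact hD.neg_log_det_nonneg
  have hprob : ∀ g : (V × V →₀ ℕ) →₀ (V × V →₀ ℕ),
      μ {ω | L ω (A none) = 0 ∧ ∀ l ∈ F, L ω {ℓ | ℓ.jumpCount = l} ∈
        (Nat.cast : ℕ → ℝ≥0∞) '' {n | n • l = g l}} =
      ENNReal.ofReal (Real.exp (-((ν (A none)).toNNReal : ℝ)) *
        ∏ l ∈ F, MvPowerSeries.coeff (g l) (poissonSeries (r l) l)) := by
    intro g
    set S : Option F → Set ℕ := fun i => i.elim {0} fun l => {n | n • l.1 = g l.1} with hS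
    have h1 : {ω | L ω (A none) = 0 ∧ ∀ l ∈ F, L ω {ℓ | ℓ.jumpCount = l} ∈
        (Nat.cast : ℕ → ℝ≥0∞) '' {n | n • l = g l}} =
        ⋂ i ∈ (Finset.univ : Finset (Option F)),
          (fun ω => L ω (A i)) ⁻¹' ((Nat.cast : ℕ → ℝ≥0∞) '' S i) := by
      ext ω
      simp only [Finset.mem_univ, Set.iInter_true, Set.mem_iInter, Option.forall, Subtype.forall,
        Set.mem_preimage, Set.mem_ofPred_eq]
      refine and_congr ?_ Iff.rfl
      simp [hS, eq_comm]
    rw [h1, hind.measure_inter_preimage_eq_mul _ fun i _ =>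
      ((S i).to_countable.image _).measurableSet]
    have h2 : ∀ i, μ ((fun ω => L ω (A i)) ⁻¹' ((Nat.cast : ℕ → ℝ≥0∞) '' S i)) =
        poissonMeasure (ν (A i)).toNNReal (S i) := fun i =>
      hL.measure_mem_image (hAm i) (hAfin i) (S i)
    simp_rw [h2]
    rw [Fintype.prod_option, ENNReal.ofReal_mul (Real.exp_pos _).le,
      ENNReal.ofReal_prod_of_nonneg fun l _ => coeff_poissonSeries_nonneg _ _ _,
      ← Finset.prod_coe_sort F]
    congr 1
    · change poissonMeasure _ {0} = _
      rw [poissonMeasure_singleton]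
      simp
    · refine Finset.prod_congr rfl fun l _ => ?_
      rw [coeff_poissonSeries, ofReal_measureReal]
      rfl
  -- There are countably many kinds, so the counts are almost surely all finite at once; kind `0` is
  -- left out.
  have hae : ∀ᵐ ω ∂μ, ∀ l : V × V →₀ ℕ, l ≠ 0 → ∃ n : ℕ, L ω {ℓ | ℓ.jumpCount = l} = n := by
    rw [ae_all_iff]
    intro l
    by_cases hl : l = 0
    · exact Filter.Eventually.of_forall fun ω h => (h hl).elim
    · filter_upwards [hL.ae_exists_natCast (measurableSet_jumpCount {l})
        (hD.loopMeasure_ne_top fun ℓ (hℓ : ℓ.jumpCount = l) => hℓ ▸ hl)] with ω hω _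
      exact hω
  have hevent : {ω | ∀ x y, jumpField (L ω) x y = k (x, y)} =ᵐ[μ]
      ⋃ g ∈ Finset.finsuppAntidiag F k, {ω | L ω (A none) = 0 ∧ ∀ l ∈ F,
        L ω {ℓ | ℓ.jumpCount = l} ∈ (Nat.cast : ℕ → ℝ≥0∞) '' {n | n • l = g l}} := by
    rw [Filter.eventuallyEq_set]
    filter_upwards [hae] with ω hω
    have := jumpField_eq_iff hω hF
    refine this.trans ?_
    simp only [Set.mem_iUnion, Set.mem_ofPred_eq, exists_prop]
    exact ⟨fun ⟨h, g, hg, hg'⟩ => ⟨g, hg, h, hg'⟩, fun ⟨g, hg, h, hg'⟩ => ⟨h, g, hg, hg'⟩⟩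
  rw [measure_congr hevent, measure_biUnion_finset]
  · simp_rw [hprob]
    rw [← ENNReal.ofReal_sum_of_nonneg, ← Finset.mul_sum, ← MvPowerSeries.coeff_prod,
      coeff_prod_poissonSeries hF hrF k le_rfl, ← mul_assoc, ← Real.exp_add, ← neg_add, htot, neg_neg,
      Real.exp_log hD.det_pos]
    exact fun g _ => mul_nonneg (Real.exp_pos _).le (Finset.prod_nonneg fun l _ =>
      coeff_poissonSeries_nonneg _ _ _)
  · intro g hg g' hg' hne
    refine Set.disjoint_left.2 fun ω hω hω' => hne ?_
    rw [Finset.mem_coe, Finset.mem_finsuppAntidiag] at hg hg'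
    ext1 l
    by_cases hl : l ∈ F
    · obtain ⟨n, hn, hn1⟩ := hω.2 l hl
      obtain ⟨m, hm, hm1⟩ := hω'.2 l hl
      have : n = m := by exact_mod_cast hn1.trans hm1.symm
      rw [← hn, ← hm, this]
    · rw [Finsupp.notMem_support_iff.1 fun h => hl (hg.2 h),
        Finsupp.notMem_support_iff.1 fun h => hl (hg'.2 h)]
  · intro g _
    have hm : ∀ B, MeasurableSet B → Measurable fun ω => L ω B := fun B hB =>
      (Measure.measurable_coe hB).comp hL.measurable
    refine MeasurableSet.inter ((hm _ (hAm none)) (measurableSet_singleton 0)) ?_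
    have hI : {ω | ∀ l ∈ F, L ω {ℓ | ℓ.jumpCount = l} ∈
        (Nat.cast : ℕ → ℝ≥0∞) '' {n | n • l = g l}} =
        ⋂ l ∈ F, {ω | L ω {ℓ | ℓ.jumpCount = l} ∈
          (Nat.cast : ℕ → ℝ≥0∞) '' {n | n • l = g l}} := by
      ext ω
      simp only [Set.mem_iInter, Set.mem_ofPred_eq]
    change MeasurableSet {ω | ∀ l ∈ F, _}
    rw [hI]
    exact F.measurableSet_biInter fun l _ => hm _ (measurableSet_jumpCount {l})
      (Set.to_countable _ |>.image _).measurableSet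

end Law

/-! ### Equality of the two laws -/

section

variable {V : Type*} [Fintype V] [DecidableEq V] {G : SimpleGraph V} {D : Conductances G}

lemma measurable_jumpField :
    Measurable fun Λ : Measure (Loop V) => jumpField Λ := by
  let _ : MeasurableSpace (V × V →₀ ℕ) := ⊤
  have hm : Measurable (Loop.jumpCount (V := V)) := fun s _ => measurableSet_jumpCount s
  refine measurable_pi_iff.2 fun x => measurable_pi_iff.2 fun y => Measure.measurable_lintegral ?_
  exact (measurable_from_top (f := fun l : V × V →₀ ℕ => (l (x, y) : ℝ≥0∞))).comp hm

lemma configurationMeasure_stepCount_eq (k : V × V →₀ ℕ) :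
    configurationMeasure G D.transition {c | c.stepCount = k} =
      ENNReal.ofReal ((1 - D.transition).det * netWeight D.transition k) := by
  rw [configurationMeasure_apply]
  exact tsum_ofReal_weight (fun _ _ => Conductances.transition_eq_zero) k

lemma hasLaw_jumpField (hD : D.IsTransient) {Ω : Type*} [MeasurableSpace Ω] (μ : Measure Ω)
    [IsProbabilityMeasure μ] {L : Ω → Measure (Loop V)}
    (hL : IsPoissonProcess L (loopMeasure D.transition) μ) :
    HasLaw (fun ω => jumpField (L ω))
      (((configurationMeasure G D.transition).map Configuration.toNetwork).map
        EulerianNetwork.toENNReal) μ := by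
  have hN : Measurable fun ω => jumpField (L ω) := measurable_jumpField.comp hL.measurable
  have hT : Measurable (EulerianNetwork.toENNReal (G := G)) := measurable_from_top
  have hC : Measurable (Configuration.toNetwork (G := G)) := measurable_from_top
  have := hD.isProbabilityMeasure
  have := Measure.isProbabilityMeasure_map
    (μ := configurationMeasure G D.transition) hC.aemeasurable
  have := Measure.isProbabilityMeasure_map
    (μ := (configurationMeasure G D.transition).map Configuration.toNetwork) hT.aemeasurable
  have := Measure.isProbabilityMeasure_map (μ := μ) hN.aemeasurable
  -- Between probability measures an inequality is an equality. It suffices to compare masses on the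
  -- countable set of finite matrices, and almost sure finiteness of the field need not be shown
  -- separately.
  refine ⟨hN.aemeasurable, (Measure.eq_of_le_of_isProbabilityMeasure ?_).symm⟩
  refine Measure.le_iff.2 fun B hB => ?_
  set F : (V × V →₀ ℕ) → V → V → ℝ≥0∞ := fun k x y => (k (x, y) : ℝ≥0∞) with hF
  have hFinj : Function.Injective F := by
    intro k k' h
    ext ⟨x, y⟩
    exact Nat.cast_injective (R := ℝ≥0∞) (congrFun (congrFun h x) y)
  have hFc : ∀ c : Configuration G, c.toNetwork.toENNReal = F c.stepCount := by
    intro c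
    funext x y
    simp only [hF, Configuration.stepCount_apply]
    rfl
  have hcount : (F ⁻¹' B).Countable := Set.to_countable _
  have hNF : ∀ k, {ω | jumpField (L ω) = F k} = {ω | ∀ x y, jumpField (L ω) x y = k (x, y)} :=
    fun k => by simp only [funext_iff, hF]
  rw [Measure.map_apply hT hB, Measure.map_apply hC (hT hB), Measure.map_apply hN hB]
  calc configurationMeasure G D.transition
        (Configuration.toNetwork ⁻¹' (EulerianNetwork.toENNReal ⁻¹' B))
      = configurationMeasure G D.transition (Configuration.stepCount ⁻¹' (F ⁻¹' B)) := by
        congr 1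
        ext c
        simp only [Set.mem_preimage, hFc]
    _ = ∑' k : F ⁻¹' B, configurationMeasure G D.transition
          (Configuration.stepCount ⁻¹' {k.1}) :=
        (tsum_measure_preimage_singleton hcount fun _ _ => MeasurableSpace.measurableSet_top).symm
    _ = ∑' k : F ⁻¹' B, μ {ω | jumpField (L ω) = F k.1} := by
        refine tsum_congr fun k => ?_
        rw [hNF, measure_jumpField_eq hD hL]
        exact configurationMeasure_stepCount_eq k.1
    _ = μ (⋃ k ∈ F ⁻¹' B, {ω | jumpField (L ω) = F k}) := by
        rw [measure_biUnion hcount]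
        · intro k _ k' _ hne
          exact Set.disjoint_left.2 fun ω (h : _ = _) (h' : _ = _) => hne (hFinj (h.symm.trans h'))
        · exact fun k _ => hN (measurableSet_singleton (F k))
    _ ≤ μ ((fun ω => jumpField (L ω)) ⁻¹' B) := by
        refine measure_mono (Set.iUnion₂_subset fun k hk ω (hω : _ = _) => ?_)
        change jumpField (L ω) ∈ B
        rw [hω]
        exact hk

end

end LoopNetworks

end

theorem mainTheorem2 {V : Type*} [Fintype V] [DecidableEq V] (G : SimpleGraph V)
    (D : LoopNetworks.Conductances G) (hD : D.IsTransient) :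
    (∀ c : LoopNetworks.Configuration G, 0 ≤ c.weight D.transition) ∧
    IsProbabilityMeasure (LoopNetworks.configurationMeasure G D.transition) ∧
    ∀ {Ω : Type*} [MeasurableSpace Ω] (μ : Measure Ω) [IsProbabilityMeasure μ]
      (L : Ω → Measure (LoopNetworks.Loop V)),
      LoopNetworks.IsPoissonProcess L (LoopNetworks.loopMeasure D.transition) μ →
      HasLaw (fun ω => LoopNetworks.jumpField (L ω))
        (((LoopNetworks.configurationMeasure G D.transition).map
          LoopNetworks.Configuration.toNetwork).map
            LoopNetworks.EulerianNetwork.toENNReal) μ := by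
  refine ⟨hD.weight_nonneg, hD.isProbabilityMeasure, ?_⟩
  intro Ω _ μ _ L hL
  exact LoopNetworks.hasLaw_jumpField hD μ hL
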